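/- Let $n,m\ge 0$ be integers and let $\overline{E}=\mathbb{C}[e_1,\dots,e_n]$ be a polynomial ring. Let $\mathrm{Maps}_{GL_n}(\mathfrak{gl}_n,\mathrm{End}((\mathbb{C}^n)^{\otimes m}))$ be the algebra, under pointwise operations, of polynomial maps $f:\mathfrak{gl}_n(\mathbb{C})\to \mathrm{End}((\mathbb{C}^n)^{\otimes m})$ with $f(gAg^{-1})=g^{\otimes m}f(A)(g^{\otimes m})^{-1}$ for all $g\in GL_n(\mathbb{C})$ and $A\in\mathfrak{gl}_n(\mathbb{C})$. It is an $\overline{E}$-algebra in which $e_k$ acts as the map $A\mapsto e_k(A)\cdot \mathrm{id}$, where $e_k(A)$ is the $k$-th elementary symmetric function of the eigenvalues of $A$. For $1\le i\le m$ let $X_i$ be the equivariant map $A\mapsto I\otimes\cdots\otimes A\otimes\cdots\otimes I$ ($A$ on the $i$-th tensor factor). Put $$\overline{R}_n^m=\overline{E}[x_1,\dots,x_m]\big/\big(x_i^n-e_1x_i^{n-1}+e_2x_i^{n-2}-\cdots+(-1)^ne_n,\ 1\le i\le m\big),$$ let $\mathrm{Sym}(\underline{x})\subset \mathrm{End}_{\overline{E}}(\overline{R}_n^m)$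 be the $\overline{E}$-subalgebra generated by the multiplications by symmetric functions in $x_1,\dots,x_m$, and let $\mathrm{End}_{\mathrm{Sym}(\underline{x})}(\overline{R}_n^m)$ be the $\overline{E}$-algebra of $\mathrm{Sym}(\underline{x})$-linear endomorphisms of $\overline{R}_n^m$. For $c=(c_1,\dots,c_n)\in\mathbb{C}^n=\mathrm{Spec}(\overline{E})$ let $s(c)\in\mathfrak{gl}_n(\mathbb{C})$ be the companion matrix with entries $1$ just below the diagonal, last column $((-1)^{n-1}c_n,\dots,-c_2,c_1)^T$, and all other entries $0$. Let $v_1,\dots,v_n$ be the standard basis of $\mathbb{C}^n$. **Theorem.** There is an isomorphism of $\overline{E}$-modules $$\psi:\overline{E}\otimes_{\mathbb{C}}(\mathbb{C}^n)^{\otimes m}\xrightarrow{\sim}\overline{R}_n^m,\qquad \psi(1\otimes v_{k_1}\otimes\cdots\otimes v_{k_m})=x_1^{k_1-1}\cdots x_m^{k_m-1},$$ and, under this identification, restriction to the slice $s$ is an isomorphism of $\overline{E}$-algebras $$\gamma:\mathrm{Maps}_{GL_n}(\mathfrak{gl}_n,\mathrm{End}((\mathbb{C}^n)^{\otimes m}))\xrightarrow{\sim}\mathrm{End}_{\mathrm{Sym}(\underline{x})}(\overline{R}_n^m).$$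 That is, for every equivariant polynomial map $f$, every $c\in\mathbb{C}^n$ and every $z\in \overline{E}\otimes(\mathbb{C}^n)^{\otimes m}$ one has $$\mathrm{ev}_c\big(\psi^{-1}(\gamma(f)(\psi(z)))\big)=f(s(c))\big(\mathrm{ev}_c(z)\big),$$ where $\mathrm{ev}_c:\overline{E}\otimes(\mathbb{C}^n)^{\otimes m}\to(\mathbb{C}^n)^{\otimes m}$ is $p\otimes t\mapsto p(c)\,t$. Moreover $\gamma(X_i)$ is multiplication by $x_i$ for every $1\le i\le m$. -/

import Mathlib

open scoped TensorProduct

noncomputable section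

namespace KostantSlice

/-- The polynomial ring `ℂ[e₁, …, eₙ]`; the variable `X k` (with `k = 0, …, n - 1`) is `e_{k+1}`. -/
abbrev Ebar (n : ℕ) : Type := MvPolynomial (Fin n) ℂ

/-- The space of matrices `𝔤𝔩ₙ = End(ℂⁿ)`. -/
abbrev Gl (n : ℕ) : Type := Matrix (Fin n) (Fin n) ℂ

/-- The tensor power `(ℂⁿ)^{⊗ m}`. -/
abbrev Tens (n m : ℕ) : Type := ⨂[ℂ] (_ : Fin m), (Fin n → ℂ)

/-- A map `𝔤𝔩ₙ → End((ℂⁿ)^{⊗ m})` is polynomial if each of its linear coordinates is a polynomial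
in the matrix entries. -/
def IsPolynomialMap {n m : ℕ} (f : Gl n → Module.End ℂ (Tens n m)) : Prop :=
  ∀ φ : Module.Dual ℂ (Module.End ℂ (Tens n m)),
    ∃ p : MvPolynomial (Fin n × Fin n) ℂ,
      ∀ A : Gl n, φ (f A) = MvPolynomial.eval (fun ij => A ij.1 ij.2) p

/-- The diagonal action of a matrix on `(ℂⁿ)^{⊗ m}`: `A ⊗ A ⊗ ⋯ ⊗ A`. -/
def tensPow {n : ℕ} (m : ℕ) (A : Gl n) : Module.End ℂ (Tens n m) :=
  PiTensorProduct.map (fun _ : Fin m => Matrix.toLin' A)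

/-- Equivariance for the conjugation actions of `GLₙ(ℂ)` on `𝔤𝔩ₙ` and on `End((ℂⁿ)^{⊗ m})`. -/
def IsEquivariant {n m : ℕ} (f : Gl n → Module.End ℂ (Tens n m)) : Prop :=
  ∀ (g : GL (Fin n) ℂ) (A : Gl n),
    f ((g : Gl n) * A * ((g⁻¹ : GL (Fin n) ℂ) : Gl n)) =
      tensPow m (g : Gl n) * f A * tensPow m ((g⁻¹ : GL (Fin n) ℂ) : Gl n)

lemma tensPow_one (n m : ℕ) : tensPow m (1 : Gl n) = 1 := by
  unfold tensPow
  rw [Matrix.toLin'_one]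
  exact PiTensorProduct.map_id

lemma tensPow_mul {n m : ℕ} (A B : Gl n) : tensPow m (A * B) = tensPow m A * tensPow m B := by
  unfold tensPow
  rw [Matrix.toLin'_mul]
  exact PiTensorProduct.map_comp _ _

lemma tensPow_inv_mul {n m : ℕ} (g : GL (Fin n) ℂ) :
    tensPow m ((g⁻¹ : GL (Fin n) ℂ) : Gl n) * tensPow m (g : Gl n) = 1 := by
  rw [← tensPow_mul, ← Units.val_mul, inv_mul_cancel, Units.val_one, tensPow_one]

lemma tensPow_mul_inv {n m : ℕ} (g : GL (Fin n) ℂ) :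
    tensPow m (g : Gl n) * tensPow m ((g⁻¹ : GL (Fin n) ℂ) : Gl n) = 1 := by
  rw [← tensPow_mul, ← Units.val_mul, mul_inv_cancel, Units.val_one, tensPow_one]

lemma IsPolynomialMap.add {n m : ℕ} {f g : Gl n → Module.End ℂ (Tens n m)}
    (hf : IsPolynomialMap f) (hg : IsPolynomialMap g) : IsPolynomialMap (f + g) := by
  intro φ
  obtain ⟨p, hp⟩ := hf φ
  obtain ⟨q, hq⟩ := hg φ
  exact ⟨p + q, fun A => by simp [hp, hq]⟩

lemma IsPolynomialMap.mul {n m : ℕ} {f g : Gl n → Module.End ℂ (Tens n m)}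
    (hf : IsPolynomialMap f) (hg : IsPolynomialMap g) : IsPolynomialMap (f * g) := by
  intro φ
  let b := Module.finBasis ℂ (Module.End ℂ (Tens n m))
  choose p hp using fun i => hf (b.coord i)
  choose q hq using fun i => hg (b.coord i)
  refine ⟨∑ i, ∑ j, MvPolynomial.C (φ (b i * b j)) * (p i * q j), fun A => ?_⟩
  have h1 : f A = ∑ i, (b.coord i (f A)) • b i := (b.sum_repr (f A)).symm
  have h2 : g A = ∑ i, (b.coord i (g A)) • b i := (b.sum_repr (g A)).symm
  rw [Pi.mul_apply, h1, h2, Finset.sum_mul_sum]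
  simp only [map_sum, hp, hq, smul_mul_smul_comm, map_smul, map_mul, MvPolynomial.eval_C,
    smul_eq_mul]
  exact Finset.sum_congr rfl fun i _ => Finset.sum_congr rfl fun j _ => mul_comm _ _

/-- If `h` is a polynomial function on `𝔤𝔩ₙ` then `A ↦ h(A) · 1` is a polynomial map. -/
lemma IsPolynomialMap.scalar {n m : ℕ} (p : MvPolynomial (Fin n × Fin n) ℂ) :
    IsPolynomialMap (fun A : Gl n => algebraMap ℂ (Module.End ℂ (Tens n m))
      (MvPolynomial.eval (fun ij => A ij.1 ij.2) p)) := by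
  intro φ
  refine ⟨p * MvPolynomial.C (φ 1), fun A => ?_⟩
  simp [Algebra.algebraMap_eq_smul_one]

lemma IsEquivariant.mul {n m : ℕ} {f g : Gl n → Module.End ℂ (Tens n m)}
    (hf : IsEquivariant f) (hg : IsEquivariant g) : IsEquivariant (f * g) := by
  intro u A
  rw [Pi.mul_apply, hf u A, hg u A, Pi.mul_apply]
  have h := tensPow_inv_mul (m := m) u
  calc _ = tensPow m (u : Gl n) * f A * (tensPow m ((u⁻¹ : GL (Fin n) ℂ) : Gl n) *
        tensPow m (u : Gl n)) * g A * tensPow m ((u⁻¹ : GL (Fin n) ℂ) : Gl n) := by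
        simp only [mul_assoc]
    _ = _ := by rw [h]; simp only [mul_assoc, one_mul]

/-- If `h` is an invariant function on `𝔤𝔩ₙ` then `A ↦ h(A) · 1` is equivariant. -/
lemma IsEquivariant.scalar {n m : ℕ} (h : Gl n → ℂ)
    (hh : ∀ (g : GL (Fin n) ℂ) (A : Gl n),
      h ((g : Gl n) * A * ((g⁻¹ : GL (Fin n) ℂ) : Gl n)) = h A) :
    IsEquivariant (fun A : Gl n => algebraMap ℂ (Module.End ℂ (Tens n m)) (h A)) := by
  intro g A
  simp only [hh]
  rw [← Algebra.commutes, mul_assoc, tensPow_mul_inv, mul_one]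

/-- `Maps_{GLₙ}(𝔤𝔩ₙ, End((ℂⁿ)^{⊗ m}))`: the `GLₙ`-equivariant polynomial maps, with pointwise
operations. -/
def equivMaps (n m : ℕ) : Subalgebra ℂ (Gl n → Module.End ℂ (Tens n m)) where
  carrier := {f | IsPolynomialMap f ∧ IsEquivariant f}
  mul_mem' hf hg := ⟨hf.1.mul hg.1, hf.2.mul hg.2⟩
  add_mem' hf hg := ⟨hf.1.add hg.1, fun u A => by
    rw [Pi.add_apply, hf.2 u A, hg.2 u A, Pi.add_apply, mul_add, add_mul]⟩
  algebraMap_mem' c := by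
    refine ⟨?_, IsEquivariant.scalar (fun _ => c) (fun _ _ => rfl)⟩
    have h := IsPolynomialMap.scalar (n := n) (m := m) (MvPolynomial.C c)
    simp only [MvPolynomial.eval_C] at h
    exact h

/-- The type of equivariant polynomial maps `𝔤𝔩ₙ → End((ℂⁿ)^{⊗ m})`. -/
abbrev EquivMaps (n m : ℕ) : Type := ↥(equivMaps n m)

/-- `eig n A k` is `e_{k+1}(A)`, the elementary symmetric function of degree `k + 1` in the
eigenvalues of `A` (with multiplicities). -/
def eig {n : ℕ} (A : Gl n) (k : Fin n) : ℂ := A.charpoly.roots.esymm ((k : ℕ) + 1)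

lemma eig_eq_coeff {n : ℕ} (A : Gl n) (k : Fin n) :
    eig A k = (-1) ^ ((k : ℕ) + 1) * A.charpoly.coeff (n - ((k : ℕ) + 1)) := by
  have hdeg : A.charpoly.natDegree = n := by simp
  have hcard : A.charpoly.roots.card = A.charpoly.natDegree :=
    (IsAlgClosed.splits A.charpoly).natDegree_eq_card_roots.symm
  have hk : (k : ℕ) + 1 ≤ n := k.2
  rw [Polynomial.coeff_eq_esymm_roots_of_card hcard (by rw [hdeg]; omega), hdeg,
    A.charpoly_monic.leadingCoeff, Nat.sub_sub_self hk, one_mul, ← mul_assoc, ← mul_pow]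
  simp [eig]

lemma eig_conj {n : ℕ} (g : GL (Fin n) ℂ) (A : Gl n) :
    eig ((g : Gl n) * A * ((g⁻¹ : GL (Fin n) ℂ) : Gl n)) = eig A := by
  funext k
  unfold eig
  rw [Matrix.coe_units_inv, Matrix.charpoly_units_conj]

/-- `e_{k+1}` is a polynomial function of the matrix entries. -/
lemma eig_polynomial {n : ℕ} (k : Fin n) : ∃ p : MvPolynomial (Fin n × Fin n) ℂ,
    ∀ A : Gl n, eig A k = MvPolynomial.eval (fun ij => A ij.1 ij.2) p := by
  refine ⟨MvPolynomial.C ((-1) ^ ((k : ℕ) + 1)) *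
    (Matrix.charpoly.univ ℂ (Fin n)).coeff (n - ((k : ℕ) + 1)), fun A => ?_⟩
  have h := Matrix.charpoly.univ_map_eval₂Hom (Fin n) (RingHom.id ℂ) (fun ij => A ij.1 ij.2)
  have h2 : (Matrix.of (Function.curry fun ij : Fin n × Fin n => A ij.1 ij.2)) = A := rfl
  rw [h2] at h
  rw [eig_eq_coeff, ← h, Polynomial.coeff_map, map_mul, MvPolynomial.eval_C]
  rfl

/-- The map `Ē → Maps_{GLₙ}(𝔤𝔩ₙ, End((ℂⁿ)^{⊗ m}))` sending `e_k` to `A ↦ e_k(A) · 1`. -/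
def scalarMap (n m : ℕ) : Ebar n →+* EquivMaps n m where
  toFun p := ⟨fun A => algebraMap ℂ _ (MvPolynomial.eval (eig A) p), by
    constructor
    · choose q hq using eig_polynomial (n := n)
      have h := IsPolynomialMap.scalar (n := n) (m := m) (MvPolynomial.bind₁ q p)
      have key : ∀ A : Gl n, MvPolynomial.eval (fun ij => A ij.1 ij.2) (MvPolynomial.bind₁ q p) =
          MvPolynomial.eval (eig A) p := by
        intro A
        clear h
        induction p using MvPolynomial.induction_on with
        | C a => simp
        | add p r hp hr => simp [hp, hr]
        | mul_X p k hp => simp [hp, hq]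
      simp only [key] at h
      exact h
    · exact IsEquivariant.scalar (fun A => MvPolynomial.eval (eig A) p)
        (fun g A => by simp only [eig_conj])⟩
  map_one' := by ext1; funext A; simp
  map_mul' p q := by ext1; funext A; simp
  map_zero' := by ext1; funext A; simp
  map_add' p q := by ext1; funext A; simp

/-- `Maps_{GLₙ}(𝔤𝔩ₙ, End((ℂⁿ)^{⊗ m}))` as an algebra over `Ē`. -/
instance (n m : ℕ) : Algebra (Ebar n) (EquivMaps n m) :=
  (scalarMap n m).toAlgebra' fun p f => by
    ext1
    funext A
    exact Algebra.commutes (MvPolynomial.eval (eig A) p) (f.1 A)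

/-- The endomorphism `1 ⊗ ⋯ ⊗ A ⊗ ⋯ ⊗ 1` with `A` in the `i`-th tensor factor. -/
def tensAt {n m : ℕ} (i : Fin m) (A : Gl n) : Module.End ℂ (Tens n m) :=
  PiTensorProduct.map (Function.update (fun _ => LinearMap.id) i (Matrix.toLin' A))

/-- `A ↦ 1 ⊗ ⋯ ⊗ A ⊗ ⋯ ⊗ 1` is linear. -/
def tensAtLin (n : ℕ) {m : ℕ} (i : Fin m) : Gl n →ₗ[ℂ] Module.End ℂ (Tens n m) where
  toFun := tensAt i
  map_add' A B := by
    unfold tensAt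
    rw [map_add]
    exact PiTensorProduct.map_update_add _ _ _ _
  map_smul' c A := by
    unfold tensAt
    rw [map_smul]
    exact PiTensorProduct.map_update_smul _ _ _ _

lemma isPolynomialMap_tensAt {n m : ℕ} (i : Fin m) :
    IsPolynomialMap (fun A : Gl n => tensAt i A) := by
  intro φ
  let L : Gl n →ₗ[ℂ] ℂ := φ ∘ₗ tensAtLin n i
  refine ⟨∑ a, ∑ b, MvPolynomial.C (L (Matrix.single a b 1)) * MvPolynomial.X (a, b),
    fun A => ?_⟩
  change L A = _
  conv_lhs => rw [Matrix.matrix_eq_sum_single A]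
  simp only [map_sum, map_mul, MvPolynomial.eval_C, MvPolynomial.eval_X]
  refine Finset.sum_congr rfl fun a _ => Finset.sum_congr rfl fun b _ => ?_
  have h : Matrix.single a b (A a b) = A a b • Matrix.single a b (1 : ℂ) := by simp
  rw [h, map_smul, smul_eq_mul, mul_comm]

lemma isEquivariant_tensAt {n m : ℕ} (i : Fin m) :
    IsEquivariant (fun A : Gl n => tensAt i A) := by
  intro g A
  have h : (Function.update (fun _ => LinearMap.id) i
        (Matrix.toLin' ((g : Gl n) * A * ((g⁻¹ : GL (Fin n) ℂ) : Gl n))) :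
          Fin m → ((Fin n → ℂ) →ₗ[ℂ] (Fin n → ℂ))) =
      fun j => Matrix.toLin' (g : Gl n) ∘ₗ
        ((Function.update (fun _ => LinearMap.id) i (Matrix.toLin' A) :
          Fin m → ((Fin n → ℂ) →ₗ[ℂ] (Fin n → ℂ))) j ∘ₗ
          Matrix.toLin' ((g⁻¹ : GL (Fin n) ℂ) : Gl n)) := by
    funext j
    by_cases hj : j = i
    · subst hj
      rw [Function.update_self, Function.update_self, mul_assoc, Matrix.toLin'_mul,
        Matrix.toLin'_mul]
    · rw [Function.update_of_ne hj, Function.update_of_ne hj, LinearMap.id_comp,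
        ← Matrix.toLin'_mul, ← Units.val_mul, mul_inv_cancel, Units.val_one, Matrix.toLin'_one]
  change PiTensorProduct.map _ = (PiTensorProduct.map _ ∘ₗ PiTensorProduct.map _) ∘ₗ
    PiTensorProduct.map _
  rw [LinearMap.comp_assoc, h, PiTensorProduct.map_comp, PiTensorProduct.map_comp]

/-- The equivariant polynomial map `X_i : A ↦ 1 ⊗ ⋯ ⊗ A ⊗ ⋯ ⊗ 1`. -/
def mapX {n m : ℕ} (i : Fin m) : EquivMaps n m :=
  ⟨fun A => tensAt i A, isPolynomialMap_tensAt i, isEquivariant_tensAt i⟩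

/-- The relation `x_iⁿ - e₁ x_iⁿ⁻¹ + e₂ x_iⁿ⁻² - ⋯ + (-1)ⁿ eₙ` in `Ē[x₁, …, xₘ]`. -/
def relation (n m : ℕ) (i : Fin m) : MvPolynomial (Fin m) (Ebar n) :=
  MvPolynomial.X i ^ n + ∑ j : Fin n,
    (-1) ^ ((j : ℕ) + 1) * MvPolynomial.C (MvPolynomial.X j : Ebar n) *
      MvPolynomial.X i ^ (n - 1 - (j : ℕ))

/-- `R̄ₙᵐ`, the quotient of `Ē[x₁, …, xₘ]` by the relations above for `i = 1, …, m`. -/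
abbrev Rbar (n m : ℕ) : Type :=
  MvPolynomial (Fin m) (Ebar n) ⧸ Ideal.span (Set.range (relation n m))

/-- The class of a polynomial in `R̄ₙᵐ`. -/
def toRbar {n m : ℕ} (p : MvPolynomial (Fin m) (Ebar n)) : Rbar n m :=
  Ideal.Quotient.mk _ p

/-- The class of the variable `x_i` in `R̄ₙᵐ`. -/
def xbar {n m : ℕ} (i : Fin m) : Rbar n m := toRbar (MvPolynomial.X i)

/-- `Sym(x)`, the `Ē`-subalgebra of `End_Ē(R̄ₙᵐ)` generated by the multiplications by symmetric
functions in `x₁, …, xₘ`. -/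
def SymX (n m : ℕ) : Subalgebra (Ebar n) (Module.End (Ebar n) (Rbar n m)) :=
  Algebra.adjoin (Ebar n)
    {T | ∃ p : MvPolynomial (Fin m) (Ebar n), p.IsSymmetric ∧
      T = Algebra.lmul (Ebar n) (Rbar n m) (toRbar p)}

/-- The slice `s(e₁, …, eₙ)`: the companion matrix with ones below the diagonal and last column
`((-1)ⁿ⁻¹ eₙ, …, -e₂, e₁)`. Here `c k` is the value of `e_{k+1}`. -/
def slice {n : ℕ} (c : Fin n → ℂ) : Gl n :=
  Matrix.of fun r s =>
    if (s : ℕ) + 1 = n then (-1) ^ (n - 1 - (r : ℕ)) * c (Fin.rev r)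
    else if (r : ℕ) = (s : ℕ) + 1 then 1 else 0

/-- The fibre at `c ∈ Spec Ē`: the map `Ē ⊗ (ℂⁿ)^{⊗ m} → (ℂⁿ)^{⊗ m}`, `p ⊗ t ↦ p(c) t`. -/
def evalAt {n : ℕ} (m : ℕ) (c : Fin n → ℂ) : (Ebar n ⊗[ℂ] Tens n m) →ₗ[ℂ] Tens n m :=
  (TensorProduct.lid ℂ (Tens n m)).toLinearMap ∘ₗ
    LinearMap.rTensor (Tens n m) (MvPolynomial.aeval c : Ebar n →ₐ[ℂ] ℂ).toLinearMap

/-- The vector `v_{k₁} ⊗ ⋯ ⊗ v_{kₘ}` of the standard basis of `(ℂⁿ)^{⊗ m}`. -/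
def stdVec {n m : ℕ} (k : Fin m → Fin n) : Tens n m :=
  PiTensorProduct.tprod ℂ fun i => (Pi.single (k i) 1 : Fin n → ℂ)

end KostantSlice

end

open KostantSlice

/-! In coordinates, restriction to the slice sends `f` to a matrix `G` over `Ebar n`, indexed by
`Fin m → Fin n`. On the monomial basis of `Rbar n m`, multiplication by `x_i` is the generic
companion matrix in the `i`-th Kronecker factor, so multiplication by `∏ q(x_i)` is the Kronecker
power of `q(companion)`. The theorem thus says that restriction is injective with image the matrices
commuting with all symmetric multiplications.

Injectivity. If `v` is cyclic for `A`, the Krylov matrix `K = (v, Av, A²v, …)` is invertible and `A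
K = K s(e(A))` (`mul_krylov`), so `A` is conjugate to a point of the slice. Cyclicity of `v` is the
nonvanishing of the polynomial `cyclicDet v`; for the first basis vector this polynomial is nonzero,
and two polynomial functions equal where it does not vanish are equal.

Image lies in the commutant. By equivariance `f(s(c))` commutes with `g^{⊗m}` for each invertible
`g` centralizing `s(c)`. For `g = s(c) + z` this is the action of `∏ (x_i + z) = ∑ z^{m-j} e_j(x)`;
comparing coefficients of powers of `z` gives commutation with each `e_j(x)`, hence with all
symmetric polynomials.

Image is everything. If `G` commutes with symmetric multiplications, it commutes with all `∏
q(x_i)`, hence at each `c` with the Kronecker powers of the centralizer of `s(c)`, which consists of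
polynomials in `s(c)`. Therefore `K^{⊗m} G(e(A)) (K⁻¹)^{⊗m}` does not depend on the cyclic vector.
Its denominator divides a power of `cyclicDet v` for the first and for the last basis vector. These
two determinants are relatively prime (`isRelPrime_cyclicDet`), so the expression is polynomial in
`A` (`exists_polynomial_extension`), and equivariance follows by density. -/

noncomputable section

namespace KostantSlice

/-! ### Kronecker products of families of matrices -/

section Kronecker

variable {n m : ℕ} {R S : Type*} [CommRing R] [CommRing S]

/-- The Kronecker product of a family of square matrices. -/
def kron (A : Fin m → Matrix (Fin n) (Fin n) R) :
    Matrix (Fin m → Fin n) (Fin m → Fin n) R :=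
  Matrix.of fun k l => ∏ i, A i (k i) (l i)

lemma kron_apply (A : Fin m → Matrix (Fin n) (Fin n) R) (k l : Fin m → Fin n) :
    kron A k l = ∏ i, A i (k i) (l i) := rfl

lemma kron_mul (A B : Fin m → Matrix (Fin n) (Fin n) R) :
    kron (fun i => A i * B i) = kron A * kron B := by
  ext k l
  simp only [kron_apply, Matrix.mul_apply, Fintype.prod_sum, Finset.prod_mul_distrib]

lemma kron_one : kron (fun _ => 1 : Fin m → Matrix (Fin n) (Fin n) R) = 1 := by
  ext k l
  simp only [kron_apply, Matrix.one_apply, Fintype.prod_ite_zero, Finset.prod_const_one,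
    ← funext_iff]

lemma kron_smul (a : R) (A : Fin m → Matrix (Fin n) (Fin n) R) :
    kron (fun i => a • A i) = a ^ m • kron A := by
  ext k l
  simp [kron_apply, Finset.prod_mul_distrib]

lemma kron_map (φ : R →+* S) (A : Fin m → Matrix (Fin n) (Fin n) R) :
    (kron A).map φ = kron fun i => (A i).map φ := by
  ext k l
  simp [kron_apply]

/-- The Kronecker power of a square matrix, as a monoid homomorphism. -/
def kronPow (m : ℕ) :
    Matrix (Fin n) (Fin n) R →* Matrix (Fin m → Fin n) (Fin m → Fin n) R where
  toFun A := kron fun _ => A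
  map_one' := kron_one
  map_mul' _ _ := kron_mul _ _

lemma kronPow_apply (A : Matrix (Fin n) (Fin n) R) : kronPow m A = kron fun _ => A := rfl

lemma kronPow_smul (a : R) (A : Matrix (Fin n) (Fin n) R) :
    kronPow m (a • A) = a ^ m • kronPow m A := kron_smul a _

lemma kronPow_map (φ : R →+* S) (A : Matrix (Fin n) (Fin n) R) :
    (kronPow m A).map φ = kronPow m (A.map φ) := kron_map φ _

end Kronecker

/-! ### Companion matrices and Krylov matrices -/

section Companion

variable {n : ℕ} {R S : Type*} [CommRing R] [CommRing S]

/-- The companion matrix over a commutative ring, with the sign conventions of `slice`. -/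
def companion (c : Fin n → R) : Matrix (Fin n) (Fin n) R :=
  Matrix.of fun r s =>
    if (s : ℕ) + 1 = n then (-1) ^ (n - 1 - (r : ℕ)) * c (Fin.rev r)
    else if (r : ℕ) = (s : ℕ) + 1 then 1 else 0

lemma slice_eq_companion (c : Fin n → ℂ) : slice c = companion c := rfl

lemma companion_map (φ : R →+* S) (c : Fin n → R) :
    (companion c).map φ = companion fun i => φ (c i) := by
  ext r s
  simp only [companion, Matrix.map_apply, Matrix.of_apply]
  split_ifs <;> simp

lemma companion_injective : Function.Injective (companion : (Fin n → R) → _) := by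
  intro c d h
  funext j
  have hn : 0 < n := j.pos
  have h1 := congrFun (congrFun h (Fin.rev j)) ⟨n - 1, by omega⟩
  have h2 : n - 1 + 1 = n := by omega
  simp only [companion, Matrix.of_apply, h2, if_true, Fin.rev_rev] at h1
  have h3 := congrArg (fun x => (-1 : R) ^ (n - 1 - (Fin.rev j : ℕ)) * x) h1
  simpa [← mul_assoc, ← mul_pow] using h3

/-- The monic polynomial `Xⁿ - c₀ Xⁿ⁻¹ + c₁ Xⁿ⁻² - ⋯`. -/
def signedPoly (c : Fin n → R) : Polynomial R :=
  Polynomial.X ^ n + ∑ j : Fin n,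
    Polynomial.C ((-1) ^ ((j : ℕ) + 1) * c j) * Polynomial.X ^ (n - 1 - (j : ℕ))

lemma signedPoly_degree_lt (c : Fin n → R) :
    (∑ j : Fin n, Polynomial.C ((-1) ^ ((j : ℕ) + 1) * c j) *
      Polynomial.X ^ (n - 1 - (j : ℕ))).degree < (n : WithBot ℕ) := by
  rw [← Polynomial.mem_degreeLT]
  refine Submodule.sum_mem _ fun j _ => Polynomial.mem_degreeLT.2 ?_
  refine (Polynomial.degree_C_mul_X_pow_le _ _).trans_lt ?_
  exact_mod_cast (by omega : n - 1 - (j : ℕ) < n)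

lemma signedPoly_monic (c : Fin n → R) : (signedPoly c).Monic :=
  Polynomial.monic_X_pow_add (signedPoly_degree_lt c)

lemma signedPoly_natDegree [Nontrivial R] (c : Fin n → R) : (signedPoly c).natDegree = n := by
  apply Polynomial.natDegree_eq_of_degree_eq_some
  rw [signedPoly, Polynomial.degree_add_eq_left_of_degree_lt, Polynomial.degree_X_pow]
  rw [Polynomial.degree_X_pow]
  exact signedPoly_degree_lt c

lemma aeval_signedPoly {A : Type*} [Ring A] [Algebra R A] (c : Fin n → R) (x : A) :
    Polynomial.aeval x (signedPoly c) =
      x ^ n + ∑ j : Fin n, ((-1) ^ ((j : ℕ) + 1) * c j) • x ^ (n - 1 - (j : ℕ)) := by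
  simp [signedPoly, Algebra.smul_def]

/-- This is Vieta's formula; the reversal `Fin.revPerm` matches the coefficient of `X ^ (n - 1 - j)`
with `e_{j+1}`. -/
lemma charpoly_eq_signedPoly (A : Gl n) : A.charpoly = signedPoly (eig A) := by
  have hd : A.charpoly.natDegree = n := by simp
  rw [A.charpoly_monic.as_sum, hd, signedPoly]
  congr 1
  rw [Finset.sum_range, ← Equiv.sum_comp Fin.revPerm]
  refine Finset.sum_congr rfl fun j _ => ?_
  have h : ((Fin.revPerm j : Fin n) : ℕ) = n - (j + 1) := by simp
  rw [h, eig_eq_coeff, ← mul_assoc, ← mul_pow, Nat.sub_add_eq, Nat.sub_right_comm]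
  simp

/-- A sequence satisfying the recursion with characteristic polynomial `signedPoly c` is shifted by
the companion matrix. -/
lemma sum_companion_smul {M : Type*} [AddCommGroup M] [Module R M] (c : Fin n → R) (w : ℕ → M)
    (h : w n + ∑ j : Fin n, ((-1) ^ ((j : ℕ) + 1) * c j) • w (n - 1 - (j : ℕ)) = 0) (s : Fin n) :
    ∑ r : Fin n, companion c r s • w r = w (s + 1) := by
  by_cases hs : (s : ℕ) + 1 = n
  · rw [hs, eq_neg_of_add_eq_zero_left h, ← Finset.sum_neg_distrib, ← Equiv.sum_comp Fin.revPerm]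
    refine Finset.sum_congr rfl fun j _ => ?_
    have h1 : ((Fin.revPerm j : Fin n) : ℕ) = n - 1 - j := by simp; omega
    have h2 : n - 1 - (n - 1 - (j : ℕ)) = j := by omega
    simp only [companion, Matrix.of_apply, hs, if_true, h1, h2]
    simp [pow_succ]
  · have hs' : (s : ℕ) + 1 < n := by omega
    rw [Finset.sum_eq_single ⟨(s : ℕ) + 1, hs'⟩]
    · simp [companion, hs]
    · intro r _ hr
      have : (r : ℕ) ≠ s + 1 := fun h => hr (Fin.ext h)
      simp [companion, hs, this]
    · simp

/-- The matrix with columns `v, A v, A² v, …`. -/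
def krylov (A : Matrix (Fin n) (Fin n) R) (v : Fin n → R) : Matrix (Fin n) (Fin n) R :=
  Matrix.of fun i j => (A ^ (j : ℕ)).mulVec v i

lemma krylov_map (φ : R →+* S) (A : Matrix (Fin n) (Fin n) R) (v : Fin n → R) :
    (krylov A v).map φ = krylov (A.map φ) (φ ∘ v) := by
  ext i j
  simp only [krylov, Matrix.map_apply, Matrix.of_apply]
  rw [RingHom.map_mulVec]
  have : (A.map φ) ^ (j : ℕ) = (A ^ (j : ℕ)).map φ := by
    simpa using (map_pow φ.mapMatrix A (j : ℕ)).symm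
  rw [this]

/-- `B` moves past the powers of `A`. When `krylov A v = 1` it follows that `B` is determined by the
single vector `B v`. -/
lemma mul_krylov_of_commute {A B : Matrix (Fin n) (Fin n) R} (h : Commute A B) (v : Fin n → R) :
    B * krylov A v = krylov A (B.mulVec v) := by
  ext i j
  have h1 : (B * krylov A v) i j = B.mulVec ((A ^ (j : ℕ)).mulVec v) i := rfl
  rw [h1, krylov, Matrix.of_apply, Matrix.mulVec_mulVec, Matrix.mulVec_mulVec,
    (h.pow_left (j : ℕ)).eq]

/-- Column `j` scales by `t ^ j`, so cyclicity of `v` is unchanged when `A` is rescaled by a nonzero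
scalar. -/
lemma krylov_smul (t : R) (A : Matrix (Fin n) (Fin n) R) (v : Fin n → R) :
    (krylov (t • A) v).det = (∏ j : Fin n, t ^ (j : ℕ)) * (krylov A v).det := by
  rw [← Matrix.det_mul_row]
  congr 1
  ext i j
  simp [krylov, smul_pow, Matrix.smul_mulVec]

/-- By Cayley–Hamilton the vectors `A ^ j v` satisfy the recursion given by the characteristic
polynomial. When `v` is cyclic, this conjugates `A` into the slice. -/
lemma mul_krylov (A : Gl n) (v : Fin n → ℂ) :
    A * krylov A v = krylov A v * slice (eig A) := by
  ext i s
  have h := sum_companion_smul (eig A) (fun j => (A ^ j).mulVec v) (by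
    have h0 := A.aeval_self_charpoly
    rw [charpoly_eq_signedPoly, aeval_signedPoly] at h0
    have h1 := congrArg (fun B => Matrix.mulVec B v) h0
    simpa [Matrix.add_mulVec, Matrix.sum_mulVec, Matrix.smul_mulVec] using h1) s
  have h1 : (A * krylov A v) i s = A.mulVec ((A ^ (s : ℕ)).mulVec v) i := rfl
  rw [h1, Matrix.mulVec_mulVec, ← pow_succ', ← h, Matrix.mul_apply, Finset.sum_apply]
  exact Finset.sum_congr rfl fun r _ => mul_comm _ _

/-- The first vector of the standard basis (when `n` is positive). -/
def firstVec (R : Type*) [CommRing R] (n : ℕ) : Fin n → R := fun i => if (i : ℕ) = 0 then 1 else 0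

/-- The last vector of the standard basis (when `n` is positive). -/
def lastVec (R : Type*) [CommRing R] (n : ℕ) : Fin n → R :=
  fun i => if (i : ℕ) + 1 = n then 1 else 0

/-- A matrix with ones on the subdiagonal shifts the standard basis along the first columns. -/
lemma pow_mulVec_firstVec (A : Matrix (Fin n) (Fin n) R)
    (h : ∀ r s : Fin n, (s : ℕ) + 1 < n → A r s = if (r : ℕ) = s + 1 then 1 else 0) (j : ℕ)
    (hj : j < n) : (A ^ j).mulVec (firstVec R n) = fun i : Fin n => if (i : ℕ) = j then 1 else 0 := by
  induction j with
  | zero => simp; rfl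
  | succ j ih =>
    rw [pow_succ', ← Matrix.mulVec_mulVec, ih (by omega)]
    funext i
    rw [Matrix.mulVec, dotProduct, Finset.sum_eq_single ⟨j, by omega⟩]
    · simp [h i ⟨j, by omega⟩ hj]
    · intro s _ hs
      have : (s : ℕ) ≠ j := fun h => hs (Fin.ext h)
      simp [this]
    · simp

lemma krylov_firstVec_eq_one (A : Matrix (Fin n) (Fin n) R)
    (h : ∀ r s : Fin n, (s : ℕ) + 1 < n → A r s = if (r : ℕ) = s + 1 then 1 else 0) :
    krylov A (firstVec R n) = 1 := by
  ext i j
  rw [krylov, Matrix.of_apply, pow_mulVec_firstVec A h j j.2]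
  simp [Matrix.one_apply, Fin.ext_iff]

/-- The companion matrix runs the first basis vector through the standard basis, so that vector is
cyclic at every point of the slice, with determinant one. -/
lemma krylov_companion (c : Fin n → R) : krylov (companion c) (firstVec R n) = 1 := by
  refine krylov_firstVec_eq_one _ fun r s hs => ?_
  simp [companion, hs.ne]

/-- With the Krylov matrix equal to `1`, `mul_krylov` reads `slice c = slice (eig (slice c))`, and
the last column determines the parameters. -/
lemma eig_slice (c : Fin n → ℂ) : eig (slice c) = c := by
  have h := mul_krylov (slice c) (firstVec ℂ n)
  rw [slice_eq_companion, krylov_companion, mul_one, one_mul] at h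
  exact (companion_injective h).symm

/-- The centralizer of a companion matrix consists of polynomials in it. -/
lemma exists_aeval_companion_of_commute (c : Fin n → R) (B : Matrix (Fin n) (Fin n) R)
    (h : Commute (companion c) B) : ∃ q : Polynomial R, B = Polynomial.aeval (companion c) q := by
  -- Elements of the centralizer are determined by their value on the cyclic vector, so `q` takes
  -- the coordinates of that value as coefficients.
  let v := B.mulVec (firstVec R n)
  let q : Polynomial R := ∑ j : Fin n, Polynomial.C (v j) * Polynomial.X ^ (j : ℕ)
  have hq : Commute (companion c) (Polynomial.aeval (companion c) q) := by
    have := (Commute.all (Polynomial.X : Polynomial R) q).map (Polynomial.aeval (companion c))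
    rwa [Polynomial.aeval_X] at this
  have h1 := mul_krylov_of_commute h (firstVec R n)
  have h2 := mul_krylov_of_commute hq (firstVec R n)
  rw [krylov_companion, mul_one] at h1 h2
  refine ⟨q, ?_⟩
  rw [h1, h2]
  congr 1
  have h3 (j : Fin n) : ((companion c) ^ (j : ℕ)).mulVec (firstVec R n) = Pi.single j 1 := by
    rw [pow_mulVec_firstVec _ (fun r s hs => by simp [companion, hs.ne]) j j.2]
    funext i
    simp [Pi.single_apply, Fin.ext_iff]
  have h4 : Polynomial.aeval (companion c) q = ∑ j : Fin n, v j • (companion c) ^ (j : ℕ) := by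
    simp [q, Algebra.smul_def]
  rw [h4, Matrix.sum_mulVec]
  simp only [Matrix.smul_mulVec, h3]
  funext i
  simp [Finset.sum_apply, Pi.single_apply, v]

end Companion

/-! ### Polynomial functions on matrices -/

section Density

variable {n m : ℕ}

/-- Evaluation at `A` of a polynomial in the matrix entries. -/
abbrev evalMat (A : Gl n) : MvPolynomial (Fin n × Fin n) ℂ →+* ℂ :=
  MvPolynomial.eval fun ij => A ij.1 ij.2

lemma evalMat_ext {p q : MvPolynomial (Fin n × Fin n) ℂ}
    (h : ∀ A : Gl n, evalMat A p = evalMat A q) : p = q :=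
  MvPolynomial.funext fun x => h (Matrix.of fun i j => x (i, j))

lemma mvPolynomialX_map_evalMat (A : Gl n) :
    (Matrix.mvPolynomialX (Fin n) (Fin n) ℂ).map (evalMat A) = A :=
  Matrix.mvPolynomialX_mapMatrix_eval A

/-- The determinant of the generic Krylov matrix: the vector `v` is cyclic for `A` when it does not
vanish at `A`. -/
def cyclicDet (v : Fin n → ℂ) : MvPolynomial (Fin n × Fin n) ℂ :=
  (krylov (Matrix.mvPolynomialX (Fin n) (Fin n) ℂ) (MvPolynomial.C ∘ v)).det

lemma krylov_mvPolynomialX_map (A : Gl n) (v : Fin n → ℂ) :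
    (krylov (Matrix.mvPolynomialX (Fin n) (Fin n) ℂ) (MvPolynomial.C ∘ v)).map (evalMat A) =
      krylov A v := by
  rw [krylov_map, mvPolynomialX_map_evalMat]
  congr 1
  funext i
  simp

lemma evalMat_cyclicDet (A : Gl n) (v : Fin n → ℂ) :
    evalMat A (cyclicDet v) = (krylov A v).det := by
  rw [cyclicDet, RingHom.map_det, RingHom.mapMatrix_apply, krylov_mvPolynomialX_map]

lemma evalMat_cyclicDet_slice (c : Fin n → ℂ) :
    evalMat (slice c) (cyclicDet (firstVec ℂ n)) = 1 := by
  rw [evalMat_cyclicDet, slice_eq_companion, krylov_companion, Matrix.det_one]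

lemma cyclicDet_firstVec_ne_zero : cyclicDet (firstVec ℂ n) ≠ 0 := by
  intro h
  have := evalMat_cyclicDet_slice (n := n) 0
  simp [h] at this

/-- The restriction of a polynomial function to a line. -/
lemma exists_polynomial_on_line (p : MvPolynomial (Fin n × Fin n) ℂ) (A B : Gl n) :
    ∃ r : Polynomial ℂ, ∀ t : ℂ, r.eval t = evalMat (A + t • B) p := by
  refine ⟨MvPolynomial.aeval
    (fun ij => Polynomial.C (A ij.1 ij.2) + Polynomial.C (B ij.1 ij.2) * Polynomial.X) p,
    fun t => ?_⟩
  induction p using MvPolynomial.induction_on with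
  | C a => simp
  | add p q hp hq => simp [hp, hq]
  | mul_X p ij hp => simp [hp, mul_comm t]

/-- A one-variable complex polynomial without roots is constant. -/
lemma evalMat_eq_of_ne_zero_on_line (p : MvPolynomial (Fin n × Fin n) ℂ) (A B : Gl n)
    (h : ∀ t : ℂ, evalMat (A + t • B) p ≠ 0) (t : ℂ) : evalMat (A + t • B) p = evalMat A p := by
  obtain ⟨r, hr⟩ := exists_polynomial_on_line p A B
  have hd : r.degree = 0 := by
    by_contra hd
    obtain ⟨t, ht⟩ := IsAlgClosed.exists_root r hd
    exact h t ((hr t).symm.trans ht)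
  have h0 := hr 0
  rw [zero_smul, add_zero] at h0
  rw [← hr t, ← h0, Polynomial.eq_C_of_degree_eq_zero hd]
  simp

/-- The lower shift matrix. -/
def lowerShift (n : ℕ) : Gl n := Matrix.of fun r s => if (r : ℕ) = s + 1 then 1 else 0

/-- The upper shift matrix. -/
def upperShift (n : ℕ) : Gl n := Matrix.of fun r s => if (r : ℕ) + 1 = s then 1 else 0

/-- For an upper Hessenberg matrix with subdiagonal entries `a`, each application reaches one
coordinate further: the Krylov matrix of the first basis vector is upper triangular with diagonal `a
^ j`. -/
lemma pow_mulVec_firstVec_of_hessenberg (A : Gl n) (a : ℂ)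
    (h0 : ∀ r s : Fin n, (s : ℕ) + 1 < r → A r s = 0)
    (h1 : ∀ r s : Fin n, (r : ℕ) = s + 1 → A r s = a) (j : ℕ) (i : Fin n) :
    (j < i → (A ^ j).mulVec (firstVec ℂ n) i = 0) ∧
      (j = i → (A ^ j).mulVec (firstVec ℂ n) i = a ^ j) := by
  induction j generalizing i with
  | zero =>
    simp only [firstVec, pow_zero, Matrix.one_mulVec]
    exact ⟨fun h => if_neg (by omega), fun h => if_pos (by omega)⟩
  | succ j ih =>
    rw [pow_succ', ← Matrix.mulVec_mulVec, Matrix.mulVec, dotProduct]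
    constructor
    · intro hj
      refine Finset.sum_eq_zero fun s _ => ?_
      by_cases hs : j < s
      · rw [(ih s).1 hs, mul_zero]
      · rw [h0 i s (by omega), zero_mul]
    · intro hj
      have hj' : j < n := by omega
      refine (Finset.sum_eq_single ⟨j, hj'⟩ (fun s _ hs => ?_) (by simp)).trans ?_
      · have : (s : ℕ) ≠ j := fun h => hs (Fin.ext h)
        by_cases hjs : j < s
        · rw [(ih s).1 hjs, mul_zero]
        · rw [h0 i s (by omega), zero_mul]
      · rw [(ih ⟨j, hj'⟩).2 rfl, h1 i ⟨j, hj'⟩ hj.symm, pow_succ']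

lemma det_krylov_shift_ne_zero {s : ℂ} (hs : s ≠ 0) (t : ℂ) :
    (krylov (s • lowerShift n + t • upperShift n) (firstVec ℂ n)).det ≠ 0 := by
  have key := pow_mulVec_firstVec_of_hessenberg (s • lowerShift n + t • upperShift n) s
    (fun i j h => by
      simp [lowerShift, upperShift, show (i : ℕ) ≠ j + 1 by omega, show (i : ℕ) + 1 ≠ j by omega])
    (fun i j h => by
      simp [lowerShift, upperShift, show (i : ℕ) = j + 1 by omega, show (j : ℕ) + 1 + 1 ≠ j by omega])
  rw [Matrix.det_of_isUpperTriangular]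
  · refine Finset.prod_ne_zero_iff.2 fun i _ => ?_
    rw [krylov, Matrix.of_apply, (key i i).2 rfl]
    exact pow_ne_zero _ hs
  · intro i j hij
    exact (key j i).1 hij

lemma pow_upperShift_mulVec_lastVec (j : ℕ) (i : Fin n) :
    (upperShift n ^ j).mulVec (lastVec ℂ n) i = if (i : ℕ) + 1 + j = n then 1 else 0 := by
  induction j generalizing i with
  | zero => simp [lastVec]
  | succ j ih =>
    rw [pow_succ', ← Matrix.mulVec_mulVec, Matrix.mulVec, dotProduct]
    simp only [ih]
    by_cases hi : (i : ℕ) + 1 < n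
    · rw [Finset.sum_eq_single ⟨(i : ℕ) + 1, hi⟩]
      · have : (i : ℕ) + 1 + 1 + j = n ↔ (i : ℕ) + 1 + (j + 1) = n := by omega
        simp [upperShift, this]
      · intro s _ hs
        have : (i : ℕ) + 1 ≠ s := fun h => hs (Fin.ext h.symm)
        simp [upperShift, this]
      · simp
    · rw [if_neg (by omega)]
      refine Finset.sum_eq_zero fun s _ => ?_
      rw [upperShift, Matrix.of_apply, if_neg (by omega), zero_mul]

lemma det_krylov_upperShift_ne_zero : (krylov (upperShift n) (lastVec ℂ n)).det ≠ 0 := by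
  have h : krylov (upperShift n) (lastVec ℂ n) =
      (1 : Gl n).submatrix id (Fin.revPerm : Equiv.Perm (Fin n)) := by
    ext i j
    rw [krylov, Matrix.of_apply, pow_upperShift_mulVec_lastVec, Matrix.submatrix_apply,
      Matrix.one_apply]
    refine if_congr ?_ rfl rfl
    simp only [id, Fin.revPerm_apply, Fin.ext_iff, Fin.val_rev]
    omega
  rw [h, Matrix.det_permute']
  simp

/-- The vanishing loci of the two cyclicity determinants have no common component. -/
lemma isRelPrime_cyclicDet :
    IsRelPrime (cyclicDet (firstVec ℂ n)) (cyclicDet (lastVec ℂ n)) := by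
  intro q hq1 hq2
  have h1 {A : Gl n} (hA : (krylov A (firstVec ℂ n)).det ≠ 0) : evalMat A q ≠ 0 := by
    rw [← evalMat_cyclicDet] at hA
    exact ne_zero_of_dvd_ne_zero hA (map_dvd _ hq1)
  have h2 {A : Gl n} (hA : (krylov A (lastVec ℂ n)).det ≠ 0) : evalMat A q ≠ 0 := by
    rw [← evalMat_cyclicDet] at hA
    exact ne_zero_of_dvd_ne_zero hA (map_dvd _ hq2)
  -- For `s ≠ 0` the first vector is cyclic along the whole line `s L + t U` (`L`, `U` the lower and
  -- upper shifts), so `q (s L) = q (s L + U)`. By polynomial identity this persists at `s = 0`: `q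
  -- 0 = q U`, which is nonzero because the last vector is cyclic for `U`.
  have h0 : evalMat (0 : Gl n) q ≠ 0 := by
    obtain ⟨r0, hr0⟩ := exists_polynomial_on_line q 0 (lowerShift n)
    obtain ⟨r1, hr1⟩ := exists_polynomial_on_line q (upperShift n) (lowerShift n)
    have h : r0 = r1 := by
      refine Polynomial.eq_of_infinite_eval_eq _ _ (Set.Infinite.mono ?_
        (Set.finite_singleton (0 : ℂ)).infinite_compl)
      intro s hs
      have := evalMat_eq_of_ne_zero_on_line q (s • lowerShift n) (upperShift n)
        (fun t => h1 (det_krylov_shift_ne_zero hs t)) 1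
      rw [one_smul, add_comm] at this
      simp only [Set.mem_ofPred_eq, hr0, hr1, zero_add, this]
    have e0 := hr0 0
    have e1 := hr1 0
    rw [zero_smul, add_zero] at e0 e1
    rw [← e0, h, e1]
    exact h2 det_krylov_upperShift_ne_zero
  -- If the first vector is cyclic for `A`, it is so for `t A` with `t ≠ 0`; together with `h0`, `q`
  -- has no zero on the line through `0` and `A`, and is constant there.
  have hc : q = MvPolynomial.C (evalMat 0 q) := by
    refine mul_right_cancel₀ (cyclicDet_firstVec_ne_zero (n := n)) (evalMat_ext fun A => ?_)
    simp only [map_mul]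
    by_cases hA : (krylov A (firstVec ℂ n)).det = 0
    · simp only [evalMat_cyclicDet, hA, mul_zero]
    · congr 1
      have := evalMat_eq_of_ne_zero_on_line q 0 A (fun t => ?_) 1
      · rw [MvPolynomial.eval_C, ← this, one_smul, zero_add]
      · rw [zero_add]
        by_cases ht : t = 0
        · rwa [ht, zero_smul]
        · refine h1 ?_
          rw [krylov_smul]
          exact mul_ne_zero (Finset.prod_ne_zero_iff.2 fun j _ => pow_ne_zero _ ht) hA
  rw [hc]
  exact (isUnit_iff_ne_zero.2 h0).map MvPolynomial.C

end Density

/-! ### Extension of equivariant maps from the slice -/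

section Extension

variable {n m : ℕ}

lemma adjugate_eq_det_smul_inv (U : GL (Fin n) ℂ) :
    (U : Gl n).adjugate = (U : Gl n).det • ((U⁻¹ : GL (Fin n) ℂ) : Gl n) := by
  have h : (U : Gl n).adjugate * (U : Gl n) * ((U⁻¹ : GL (Fin n) ℂ) : Gl n) = _ :=
    congrArg (· * _) (Matrix.adjugate_mul (U : Gl n))
  rwa [mul_assoc, Units.mul_inv, mul_one, Matrix.smul_mul, one_mul] at h

/-- The value at `A` of the equivariant map with value `G` at `slice c` does not depend on the
matrix that conjugates `slice c` to `A`. -/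
lemma conj_eq_of_mul_eq_mul_slice {c : Fin n → ℂ}
    {G : Matrix (Fin m → Fin n) (Fin m → Fin n) ℂ}
    (hG : ∀ q : Polynomial ℂ, Commute G (kronPow m (Polynomial.aeval (slice c) q)))
    {A : Gl n} {U V : GL (Fin n) ℂ} (hU : A * (U : Gl n) = (U : Gl n) * slice c)
    (hV : A * (V : Gl n) = (V : Gl n) * slice c) :
    kronPow m (U : Gl n) * G * kronPow m ((U⁻¹ : GL (Fin n) ℂ) : Gl n) =
      kronPow m (V : Gl n) * G * kronPow m ((V⁻¹ : GL (Fin n) ℂ) : Gl n) := by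
  have hA : ((U⁻¹ : GL (Fin n) ℂ) : Gl n) * A = slice c * ((U⁻¹ : GL (Fin n) ℂ) : Gl n) := by
    rw [← Units.mul_left_inj U, mul_assoc, mul_assoc, hU, ← mul_assoc, Units.inv_mul, one_mul,
      mul_one]
  have hc : Commute (slice c) ((U⁻¹ * V : GL (Fin n) ℂ) : Gl n) := by
    rw [commute_iff_eq, Units.val_mul, ← mul_assoc, ← hA, mul_assoc, hV, mul_assoc]
  obtain ⟨q, hq⟩ := exists_aeval_companion_of_commute c _ hc
  have hB : Commute G (kronPow m ((U⁻¹ * V : GL (Fin n) ℂ) : Gl n)) := hq ▸ hG q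
  have hV' : kronPow m (V : Gl n) =
      kronPow m (U : Gl n) * kronPow m ((U⁻¹ * V : GL (Fin n) ℂ) : Gl n) := by
    rw [← map_mul, ← Units.val_mul, mul_inv_cancel_left]
  have hU' : kronPow m ((U⁻¹ : GL (Fin n) ℂ) : Gl n) =
      kronPow m ((U⁻¹ * V : GL (Fin n) ℂ) : Gl n) * kronPow m ((V⁻¹ : GL (Fin n) ℂ) : Gl n) := by
    rw [← map_mul, ← Units.val_mul, mul_inv_cancel_right]
  rw [hU', hV', ← mul_assoc, mul_assoc _ G, hB.eq, ← mul_assoc]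

lemma cyclicDet_lastVec_ne_zero : cyclicDet (lastVec ℂ n) ≠ 0 := by
  intro h
  have := det_krylov_upperShift_ne_zero (n := n)
  rw [← evalMat_cyclicDet, h, map_zero] at this
  exact this rfl

/-- A family of matrices on the slice which commutes with the centralizers extends to a polynomial
function on all matrices. -/
theorem exists_polynomial_extension (G : Matrix (Fin m → Fin n) (Fin m → Fin n) (Ebar n))
    (hG : ∀ (c : Fin n → ℂ) (q : Polynomial ℂ),
      Commute (G.map (MvPolynomial.eval c)) (kronPow m (Polynomial.aeval (slice c) q))) :
    ∃ N : Matrix (Fin m → Fin n) (Fin m → Fin n) (MvPolynomial (Fin n × Fin n) ℂ),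
      ∀ (A : Gl n) (U : GL (Fin n) ℂ), evalMat A (cyclicDet (firstVec ℂ n)) ≠ 0 →
        A * (U : Gl n) = (U : Gl n) * slice (eig A) →
        N.map (evalMat A) = kronPow m (U : Gl n) * G.map (MvPolynomial.eval (eig A)) *
          kronPow m ((U⁻¹ : GL (Fin n) ℂ) : Gl n) := by
  choose p hp using eig_polynomial (n := n)
  let K (v : Fin n → ℂ) := krylov (Matrix.mvPolynomialX (Fin n) (Fin n) ℂ) (MvPolynomial.C ∘ v)
  -- The adjugate replaces the inverse of the Krylov matrix, at the cost of a factor `cyclicDet v ^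
  -- m`.
  let num (v : Fin n → ℂ) := kronPow m (K v) *
    G.map (MvPolynomial.bind₁ p : Ebar n →ₐ[ℂ] _).toRingHom * kronPow m (K v).adjugate
  have hGp (A : Gl n) : (G.map (MvPolynomial.bind₁ p : Ebar n →ₐ[ℂ] _).toRingHom).map
      (evalMat A) = G.map (MvPolynomial.eval (eig A)) := by
    ext k l
    simp only [Matrix.map_apply]
    generalize G k l = e
    induction e using MvPolynomial.induction_on with
    | C a => simp
    | add e f he hf => simp only [map_add, he, hf]
    | mul_X e j he =>
      simp only [map_mul, he]
      simp [hp]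
  have hnum (v : Fin n → ℂ) (A : Gl n) (U : GL (Fin n) ℂ)
      (hd : evalMat A (cyclicDet v) ≠ 0) (hU : A * (U : Gl n) = (U : Gl n) * slice (eig A)) :
      (num v).map (evalMat A) = evalMat A (cyclicDet v) ^ m •
        (kronPow m (U : Gl n) * G.map (MvPolynomial.eval (eig A)) *
          kronPow m ((U⁻¹ : GL (Fin n) ℂ) : Gl n)) := by
    rw [evalMat_cyclicDet] at hd ⊢
    let V : GL (Fin n) ℂ := Matrix.GeneralLinearGroup.mkOfDetNeZero (krylov A v) hd
    have hV : (V : Gl n) = krylov A v := rfl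
    have hK : (K v).adjugate.map (evalMat A) = (V : Gl n).adjugate := by
      rw [hV, ← krylov_mvPolynomialX_map, ← RingHom.mapMatrix_apply, ← RingHom.mapMatrix_apply,
        RingHom.map_adjugate]
    rw [conj_eq_of_mul_eq_mul_slice (hG _) hU (V := V) (mul_krylov A v)]
    simp only [num]
    rw [Matrix.map_mul, Matrix.map_mul, kronPow_map, kronPow_map, hGp, krylov_mvPolynomialX_map, hK,
      adjugate_eq_det_smul_inv, kronPow_smul, Matrix.mul_smul, hV]
  have hcomp (k l : Fin m → Fin n) : num (firstVec ℂ n) k l * cyclicDet (lastVec ℂ n) ^ m =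
      num (lastVec ℂ n) k l * cyclicDet (firstVec ℂ n) ^ m := by
    -- Multiplying by both nonzero determinants leaves only matrices for which both vectors are
    -- cyclic, where the two conjugates agree.
    refine mul_left_cancel₀ (mul_ne_zero (cyclicDet_firstVec_ne_zero (n := n))
      cyclicDet_lastVec_ne_zero) (evalMat_ext fun A => ?_)
    by_cases hf : evalMat A (cyclicDet (firstVec ℂ n)) = 0
    · simp only [map_mul, hf, zero_mul]
    by_cases hl : evalMat A (cyclicDet (lastVec ℂ n)) = 0
    · simp only [map_mul, hl, zero_mul, mul_zero]
    have hd := hf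
    rw [evalMat_cyclicDet] at hd
    let U : GL (Fin n) ℂ := Matrix.GeneralLinearGroup.mkOfDetNeZero (krylov A (firstVec ℂ n)) hd
    have hU : A * (U : Gl n) = (U : Gl n) * slice (eig A) := mul_krylov A _
    have e1 := congrFun (congrFun (hnum _ A U hf hU) k) l
    have e2 := congrFun (congrFun (hnum _ A U hl hU) k) l
    rw [Matrix.map_apply, Matrix.smul_apply, smul_eq_mul] at e1 e2
    simp only [map_mul, map_pow, e1, e2]
    ring
  have hdvd (k l : Fin m → Fin n) : cyclicDet (firstVec ℂ n) ^ m ∣ num (firstVec ℂ n) k l :=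
    ((isRelPrime_cyclicDet (n := n)).pow_left.pow_right).dvd_of_dvd_mul_right
      ⟨num (lastVec ℂ n) k l, by rw [hcomp, mul_comm]⟩
  choose N hN using hdvd
  refine ⟨Matrix.of N, fun A U hd hU => ?_⟩
  have h := hnum _ A U hd hU
  ext k l
  have e := congrFun (congrFun h k) l
  rw [Matrix.map_apply, Matrix.smul_apply, smul_eq_mul, hN, map_mul, map_pow] at e
  exact mul_left_cancel₀ (pow_ne_zero _ hd) e

/-- The matrix `g X g⁻¹`, for `X` the generic matrix. -/
def genericConj (g : GL (Fin n) ℂ) :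
    Matrix (Fin n) (Fin n) (MvPolynomial (Fin n × Fin n) ℂ) :=
  (g : Gl n).map MvPolynomial.C * Matrix.mvPolynomialX (Fin n) (Fin n) ℂ *
    ((g⁻¹ : GL (Fin n) ℂ) : Gl n).map MvPolynomial.C

/-- Substitution of `g X g⁻¹` for the generic matrix `X`. -/
def conjSubst (g : GL (Fin n) ℂ) :
    MvPolynomial (Fin n × Fin n) ℂ →+* MvPolynomial (Fin n × Fin n) ℂ :=
  MvPolynomial.eval₂Hom MvPolynomial.C fun ij => genericConj g ij.1 ij.2

lemma map_C_map_evalMat {ι : Type*} (A : Gl n) (B : Matrix ι ι ℂ) :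
    (B.map (MvPolynomial.C : ℂ →+* MvPolynomial (Fin n × Fin n) ℂ)).map (evalMat A) = B := by
  ext i j
  simp

lemma evalMat_conjSubst (g : GL (Fin n) ℂ) (A : Gl n) (p : MvPolynomial (Fin n × Fin n) ℂ) :
    evalMat A (conjSubst g p) =
      evalMat ((g : Gl n) * A * ((g⁻¹ : GL (Fin n) ℂ) : Gl n)) p := by
  induction p using MvPolynomial.induction_on with
  | C a => simp [conjSubst]
  | add p q hp hq => simp only [map_add, hp, hq]
  | mul_X p ij hp =>
    simp only [map_mul, hp]
    congr 1
    have h : (genericConj g).map (evalMat A) =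
        (g : Gl n) * A * ((g⁻¹ : GL (Fin n) ℂ) : Gl n) := by
      rw [genericConj, Matrix.map_mul, Matrix.map_mul, map_C_map_evalMat, map_C_map_evalMat,
        mvPolynomialX_map_evalMat]
    rw [conjSubst, MvPolynomial.eval₂Hom_X', MvPolynomial.eval_X, ← h, Matrix.map_apply]

/-- The extension of `exists_polynomial_extension` can be taken equivariant. -/
theorem exists_equivariant_extension (G : Matrix (Fin m → Fin n) (Fin m → Fin n) (Ebar n))
    (hG : ∀ (c : Fin n → ℂ) (q : Polynomial ℂ),
      Commute (G.map (MvPolynomial.eval c)) (kronPow m (Polynomial.aeval (slice c) q))) :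
    ∃ N : Matrix (Fin m → Fin n) (Fin m → Fin n) (MvPolynomial (Fin n × Fin n) ℂ),
      (∀ c : Fin n → ℂ, N.map (evalMat (slice c)) = G.map (MvPolynomial.eval c)) ∧
      ∀ (g : GL (Fin n) ℂ) (A : Gl n),
        N.map (evalMat ((g : Gl n) * A * ((g⁻¹ : GL (Fin n) ℂ) : Gl n))) =
          kronPow m (g : Gl n) * N.map (evalMat A) *
            kronPow m ((g⁻¹ : GL (Fin n) ℂ) : Gl n) := by
  obtain ⟨N, hN⟩ := exists_polynomial_extension G hG
  refine ⟨N, fun c => ?_, fun g A => ?_⟩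
  · have h := hN (slice c) 1 (by rw [evalMat_cyclicDet_slice]; exact one_ne_zero)
      (by rw [eig_slice, Units.val_one, mul_one, one_mul])
    rwa [eig_slice, inv_one, Units.val_one, map_one, mul_one, one_mul] at h
  · let d := cyclicDet (firstVec ℂ n)
    let N' := (kronPow m (g : Gl n)).map MvPolynomial.C * N *
      (kronPow m ((g⁻¹ : GL (Fin n) ℂ) : Gl n)).map MvPolynomial.C
    have hN' (A : Gl n) : N'.map (evalMat A) = kronPow m (g : Gl n) * N.map (evalMat A) *
        kronPow m ((g⁻¹ : GL (Fin n) ℂ) : Gl n) := by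
      simp only [N']
      rw [Matrix.map_mul, Matrix.map_mul, map_C_map_evalMat, map_C_map_evalMat]
    -- Its value at `g⁻¹ * slice 0 * g` is the value of `d` on the slice, namely one.
    have hd : conjSubst g d ≠ 0 := by
      intro h
      have h1 := evalMat_conjSubst g (((g⁻¹ : GL (Fin n) ℂ) : Gl n) * slice 0 * (g : Gl n)) d
      rw [h, map_zero, mul_assoc, mul_assoc, Units.mul_inv, mul_one, ← mul_assoc, Units.mul_inv,
        one_mul, evalMat_cyclicDet_slice] at h1
      exact zero_ne_one h1
    -- It suffices to compare where the first vector is cyclic for both `A` and `g A g⁻¹`; there, if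
    -- `U` conjugates the slice point to `A`, then `g * U` conjugates it to `g A g⁻¹`.
    have key : N.map (conjSubst g) = N' := by
      ext1 k l
      refine mul_left_cancel₀ (mul_ne_zero (cyclicDet_firstVec_ne_zero (n := n)) hd)
        (evalMat_ext fun A => ?_)
      by_cases h0 : evalMat A d = 0
      · simp only [map_mul, d, h0, zero_mul]
      by_cases h1 : evalMat A (conjSubst g d) = 0
      · simp only [map_mul, d, h1, zero_mul, mul_zero]
      suffices h : evalMat A (conjSubst g (N k l)) = evalMat A (N' k l) by
        simp only [map_mul, Matrix.map_apply, h]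
      rw [evalMat_conjSubst] at h1
      have hdet := h0
      rw [evalMat_cyclicDet] at hdet
      let U : GL (Fin n) ℂ :=
        Matrix.GeneralLinearGroup.mkOfDetNeZero (krylov A (firstVec ℂ n)) hdet
      have hU : A * (U : Gl n) = (U : Gl n) * slice (eig A) := mul_krylov A _
      have e0 := hN A U h0 hU
      have e1 := hN _ (g * U) h1 (by
        rw [eig_conj, Units.val_mul, mul_assoc, mul_assoc, ← mul_assoc _ (g : Gl n), Units.inv_mul,
          one_mul, hU, mul_assoc])
      have e2 : N.map (evalMat ((g : Gl n) * A * ((g⁻¹ : GL (Fin n) ℂ) : Gl n))) =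
          N'.map (evalMat A) := by
        rw [e1, hN', e0, eig_conj, mul_inv_rev, Units.val_mul, Units.val_mul, map_mul, map_mul]
        simp only [mul_assoc]
      have e3 := congrFun (congrFun e2 k) l
      rw [Matrix.map_apply, Matrix.map_apply] at e3
      rw [evalMat_conjSubst, e3]
    rw [← hN', ← key]
    ext k l
    simp only [Matrix.map_apply, evalMat_conjSubst]

end Extension

/-! ### The monomial basis -/

section MonomialBasis

variable {n m : ℕ} {R B : Type*} [CommRing R] [CommRing B] [Algebra R B] {c : Fin n → R}

/-- Multiplication by `q(x)` in terms of the powers of `x`, for a root `x` of `signedPoly c`. -/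
lemma aeval_mul_pow {x : B} (hx : Polynomial.aeval x (signedPoly c) = 0) (q : Polynomial R)
    (s : Fin n) : Polynomial.aeval x q * x ^ (s : ℕ) =
      ∑ r : Fin n, Polynomial.aeval (companion c) q r s • x ^ (r : ℕ) := by
  induction q using Polynomial.induction_on generalizing s with
  | C a =>
    rw [Polynomial.aeval_C, Polynomial.aeval_C, ← Algebra.smul_def, Finset.sum_eq_single s]
    · simp [Matrix.algebraMap_matrix_apply]
    · intro r _ hr
      simp [Matrix.algebraMap_matrix_apply, hr]
    · simp
  | add p q hp hq => simp only [map_add, add_mul, hp, hq, Matrix.add_apply, add_smul,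
      Finset.sum_add_distrib]
  | monomial k a h =>
    have hx (s : Fin n) : x * x ^ (s : ℕ) = ∑ r : Fin n, companion c r s • x ^ (r : ℕ) := by
      rw [← pow_succ']
      refine (sum_companion_smul c (fun k => x ^ k) ?_ s).symm
      rw [← aeval_signedPoly, hx]
    have hM : Polynomial.aeval (companion c) (Polynomial.C a * Polynomial.X ^ (k + 1)) =
        Polynomial.aeval (companion c) (Polynomial.C a * Polynomial.X ^ k) * companion c := by
      rw [pow_succ, ← mul_assoc, map_mul, Polynomial.aeval_X]
    rw [hM, pow_succ, ← mul_assoc, map_mul _ _ Polynomial.X, Polynomial.aeval_X, mul_assoc, hx,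
      Finset.mul_sum]
    simp only [Algebra.mul_smul_comm, h, Finset.smul_sum, Matrix.mul_apply, Finset.sum_smul,
      smul_smul]
    rw [Finset.sum_comm]
    simp only [mul_comm]

/-- The one-variable formula applies in each factor. No independence of the monomials is assumed, so
this serves both to prove that they span and to compute matrices. -/
lemma prod_aeval_mul_prod_pow {x : Fin m → B}
    (hx : ∀ i, Polynomial.aeval (x i) (signedPoly c) = 0) (q : Fin m → Polynomial R)
    (l : Fin m → Fin n) :
    (∏ i, Polynomial.aeval (x i) (q i)) * ∏ i, x i ^ (l i : ℕ) =
      ∑ k, kron (fun i => Polynomial.aeval (companion c) (q i)) k l • ∏ i, x i ^ (k i : ℕ) := by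
  simp only [← Finset.prod_mul_distrib, fun i => aeval_mul_pow (hx i), Fintype.prod_sum,
    kron_apply]
  refine Finset.sum_congr rfl fun k _ => ?_
  simp only [Algebra.smul_def, Finset.prod_mul_distrib, map_prod]

lemma prod_aeval_update (x : Fin m → B) (i : Fin m) (q : Polynomial R) :
    ∏ j, Polynomial.aeval (x j) ((Function.update (fun _ => 1) i q : Fin m → Polynomial R) j) =
      Polynomial.aeval (x i) q := by
  rw [Finset.prod_eq_single i (fun j _ hj => by simp [hj]) (by simp), Function.update_self]

lemma aeval_companion_update (c : Fin n → R) (i : Fin m) :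
    (fun j => Polynomial.aeval (companion c)
      ((Function.update (fun _ => 1) i Polynomial.X : Fin m → Polynomial R) j)) =
      Function.update (fun _ => 1) i (companion c) := by
  funext j
  by_cases hj : j = i
  · subst hj; simp
  · simp [hj]

lemma mul_prod_pow {x : Fin m → B} (hx : ∀ i, Polynomial.aeval (x i) (signedPoly c) = 0)
    (i : Fin m) (l : Fin m → Fin n) : x i * ∏ i, x i ^ (l i : ℕ) =
      ∑ k, kron (Function.update (fun _ => 1) i (companion c)) k l • ∏ i, x i ^ (k i : ℕ) := by
  have h := prod_aeval_mul_prod_pow hx (Function.update (fun _ => 1) i Polynomial.X) l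
  rwa [prod_aeval_update, Polynomial.aeval_X, aeval_companion_update] at h

/-- If `B` is generated by roots of `signedPoly c`, it is spanned by the monomials in them of degree
less than `n` in each. -/
lemma span_prod_pow {x : Fin m → B} (hx : ∀ i, Polynomial.aeval (x i) (signedPoly c) = 0)
    (hB : Function.Surjective (MvPolynomial.aeval x : MvPolynomial (Fin m) R →ₐ[R] B)) :
    Submodule.span R (Set.range fun k : Fin m → Fin n => ∏ i, x i ^ (k i : ℕ)) = ⊤ := by
  set W := Submodule.span R (Set.range fun k : Fin m → Fin n => ∏ i, x i ^ (k i : ℕ))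
  have h1 : (1 : B) ∈ W := by
    rcases isEmpty_or_nonempty (Fin m → Fin n) with h | ⟨⟨k⟩⟩
    -- Without exponents one has `n = 0` and `m > 0`; then `signedPoly c = 1`, and having a root
    -- forces `1 = 0` in `B`.
    · obtain ⟨i, hi⟩ := isEmpty_pi.1 h
      obtain rfl : n = 0 := by
        by_contra hn
        exact hi.false ⟨0, by omega⟩
      have h := hx i
      simp only [signedPoly, Finset.univ_eq_empty, Finset.sum_empty, pow_zero, add_zero,
        map_one] at h
      rw [h]
      exact W.zero_mem
    · by_cases hm : m = 0
      · subst hm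
        exact Submodule.subset_span ⟨k, by simp⟩
      · have hn : 0 < n := (k ⟨0, by omega⟩).pos
        exact Submodule.subset_span ⟨fun _ => ⟨0, hn⟩, by simp⟩
  have hxW (i : Fin m) (y : B) (hy : y ∈ W) : y * x i ∈ W := by
    induction hy using Submodule.span_induction with
    | mem y hy =>
      obtain ⟨l, rfl⟩ := hy
      rw [mul_comm, mul_prod_pow hx]
      exact W.sum_mem fun k _ => W.smul_mem _ (Submodule.subset_span ⟨k, rfl⟩)
    | zero => rw [zero_mul]; exact W.zero_mem
    | add y z _ _ hy hz => rw [add_mul]; exact W.add_mem hy hz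
    | smul a y _ hy => rw [smul_mul_assoc]; exact W.smul_mem _ hy
  rw [eq_top_iff]
  rintro y -
  obtain ⟨p, rfl⟩ := hB y
  induction p using MvPolynomial.induction_on with
  | C a =>
    rw [MvPolynomial.aeval_C, Algebra.algebraMap_eq_smul_one]
    exact W.smul_mem _ h1
  | add p q hp hq => rw [map_add]; exact W.add_mem hp hq
  | mul_X p i hp => rw [map_mul, MvPolynomial.aeval_X]; exact hxW i _ hp

/-- The algebra obtained by adjoining one root of `signedPoly c`. -/
abbrev OneVar (c : Fin n → R) : Type _ := AdjoinRoot (signedPoly c)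

/-- The basis of powers of the root in `OneVar c`. -/
def oneVarBasis [Nontrivial R] (c : Fin n → R) : Module.Basis (Fin n) R (OneVar c) :=
  (AdjoinRoot.powerBasis' (signedPoly_monic c)).basis.reindex (finCongr (signedPoly_natDegree c))

lemma oneVarBasis_apply [Nontrivial R] (j : Fin n) :
    oneVarBasis c j = AdjoinRoot.root (signedPoly c) ^ (j : ℕ) := by
  simp [oneVarBasis]
  rfl

/-- The evaluation of polynomials in `m` variables in the tensor power of `OneVar c`. -/
def evalOneVar (m : ℕ) (c : Fin n → R) :
    MvPolynomial (Fin m) R →ₐ[R] ⨂[R] (_ : Fin m), OneVar c :=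
  MvPolynomial.aeval fun i : Fin m =>
    PiTensorProduct.singleAlgHom (R := R) (A := fun _ : Fin m => OneVar c) i
      (AdjoinRoot.root (signedPoly c))

lemma evalOneVar_signedPoly (i : Fin m) :
    evalOneVar m c (Polynomial.aeval (MvPolynomial.X i) (signedPoly c)) = 0 := by
  rw [← Polynomial.aeval_algHom_apply, evalOneVar, MvPolynomial.aeval_X,
    Polynomial.aeval_algHom_apply, AdjoinRoot.aeval_eq, AdjoinRoot.mk_self, map_zero]

lemma prod_singleAlgHom {R ι : Type*} {A : ι → Type*} [Fintype ι] [DecidableEq ι] [CommRing R]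
    [∀ i, CommRing (A i)] [∀ i, Algebra R (A i)] (a : ∀ i, A i) :
    ∏ i, PiTensorProduct.singleAlgHom (R := R) i (a i) = PiTensorProduct.tprod R a := by
  simp only [PiTensorProduct.singleAlgHom_apply, ← PiTensorProduct.tprod_prod]
  congr 1
  exact Finset.univ_prod_mulSingle a

lemma evalOneVar_prod_pow [Nontrivial R] (k : Fin m → Fin n) :
    evalOneVar m c (∏ i, MvPolynomial.X i ^ (k i : ℕ)) =
      Basis.piTensorProduct (fun _ : Fin m => oneVarBasis c) k := by
  rw [Basis.piTensorProduct_apply, map_prod]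
  simp only [map_pow, evalOneVar, MvPolynomial.aeval_X, oneVarBasis_apply]
  simp only [← map_pow]
  exact prod_singleAlgHom _

variable {π : MvPolynomial (Fin m) R →ₐ[R] B}

lemma aeval_signedPoly_of_ker (hker : RingHom.ker π =
      Ideal.span (Set.range fun i : Fin m => Polynomial.aeval (MvPolynomial.X i) (signedPoly c)))
    (i : Fin m) : Polynomial.aeval (π (MvPolynomial.X i)) (signedPoly c) = 0 := by
  rw [Polynomial.aeval_algHom_apply, ← RingHom.mem_ker, hker]
  exact Ideal.subset_span ⟨i, rfl⟩

/-- Evaluation in the tensor power of `OneVar c` kills the relations and sends these monomials to a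
tensor product basis, so a relation among them has zero coefficients. -/
lemma linearIndependent_prod_pow [Nontrivial R] (hker : RingHom.ker π =
      Ideal.span (Set.range fun i : Fin m => Polynomial.aeval (MvPolynomial.X i) (signedPoly c))) :
    LinearIndependent R fun k : Fin m → Fin n => ∏ i, π (MvPolynomial.X i) ^ (k i : ℕ) := by
  rw [Fintype.linearIndependent_iff]
  intro a ha
  have h1 : (∑ k, a k • ∏ i, MvPolynomial.X i ^ (k i : ℕ)) ∈ RingHom.ker π := by
    rw [RingHom.mem_ker]
    simpa only [map_sum, map_smul, map_prod, map_pow] using ha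
  have h2 : RingHom.ker π ≤ RingHom.ker (evalOneVar m c) := by
    rw [hker, Ideal.span_le]
    rintro _ ⟨i, rfl⟩
    exact evalOneVar_signedPoly i
  have h3 := h2 h1
  simp only [RingHom.mem_ker, map_sum, map_smul, evalOneVar_prod_pow] at h3
  exact Fintype.linearIndependent_iff.1
    (Basis.piTensorProduct fun _ : Fin m => oneVarBasis c).linearIndependent a h3

/-- The monomial basis of a quotient of a polynomial ring in `m` variables by the same monic
polynomial of degree `n` in each variable. -/
def monomBasis [Nontrivial R] (hπ : Function.Surjective π) (hker : RingHom.ker π =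
      Ideal.span (Set.range fun i : Fin m => Polynomial.aeval (MvPolynomial.X i) (signedPoly c))) :
    Module.Basis (Fin m → Fin n) R B :=
  Module.Basis.mk (linearIndependent_prod_pow hker)
    (span_prod_pow (aeval_signedPoly_of_ker hker)
      fun y => (hπ y).imp fun p hp =>
        (DFunLike.congr_fun (MvPolynomial.aeval_unique π) p).symm.trans hp).ge

lemma monomBasis_apply [Nontrivial R] (hπ : Function.Surjective π) (hker : RingHom.ker π =
      Ideal.span (Set.range fun i : Fin m => Polynomial.aeval (MvPolynomial.X i) (signedPoly c)))
    (k : Fin m → Fin n) : monomBasis hπ hker k = ∏ i, π (MvPolynomial.X i) ^ (k i : ℕ) :=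
  Module.Basis.mk_apply _ _ _

lemma leftMulMatrix_prod_aeval {x : Fin m → B} (β : Module.Basis (Fin m → Fin n) R B)
    (hβ : ∀ k, β k = ∏ i, x i ^ (k i : ℕ))
    (hx : ∀ i, Polynomial.aeval (x i) (signedPoly c) = 0) (q : Fin m → Polynomial R) :
    Algebra.leftMulMatrix β (∏ i, Polynomial.aeval (x i) (q i)) =
      kron fun i => Polynomial.aeval (companion c) (q i) := by
  ext k l
  have h := prod_aeval_mul_prod_pow hx q l
  simp only [← hβ] at h
  rw [Algebra.leftMulMatrix_eq_repr_mul, h, Module.Basis.repr_sum_self]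

lemma leftMulMatrix_root {x : Fin m → B} (β : Module.Basis (Fin m → Fin n) R B)
    (hβ : ∀ k, β k = ∏ i, x i ^ (k i : ℕ))
    (hx : ∀ i, Polynomial.aeval (x i) (signedPoly c) = 0) (i : Fin m) :
    Algebra.leftMulMatrix β (x i) = kron (Function.update (fun _ => 1) i (companion c)) := by
  have h := leftMulMatrix_prod_aeval β hβ hx (Function.update (fun _ => 1) i Polynomial.X)
  rwa [prod_aeval_update, Polynomial.aeval_X, aeval_companion_update] at h

end MonomialBasis

/-! ### Equivariant maps as polynomial matrices on the slice -/

section SliceMatrix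

variable {n m : ℕ}

/-- The generic companion matrix. -/
abbrev genericCompanion (n : ℕ) : Matrix (Fin n) (Fin n) (Ebar n) := companion MvPolynomial.X

lemma genericCompanion_map_eval (c : Fin n → ℂ) :
    (genericCompanion n).map (MvPolynomial.eval c) = slice c := by
  rw [companion_map, slice_eq_companion]
  congr 1
  funext i
  simp

lemma matrix_ext_eval {ι : Type*} {G H : Matrix ι ι (Ebar n)}
    (h : ∀ c : Fin n → ℂ, G.map (MvPolynomial.eval c) = H.map (MvPolynomial.eval c)) : G = H := by
  ext1 k l
  exact MvPolynomial.funext fun c => congrFun (congrFun (h c) k) l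

/-- The standard basis of `(ℂⁿ)^{⊗ m}`. -/
def tensBasis (n m : ℕ) : Module.Basis (Fin m → Fin n) ℂ (Tens n m) :=
  Basis.piTensorProduct fun _ => Pi.basisFun ℂ (Fin n)

lemma tensBasis_apply (k : Fin m → Fin n) : tensBasis n m k = stdVec k := by
  rw [tensBasis, Basis.piTensorProduct_apply, stdVec]
  simp only [Pi.basisFun_apply]

/-- The matrix of an endomorphism of `(ℂⁿ)^{⊗ m}`. -/
def tensMatrix (n m : ℕ) :
    Module.End ℂ (Tens n m) ≃ₐ[ℂ] Matrix (Fin m → Fin n) (Fin m → Fin n) ℂ :=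
  LinearMap.toMatrixAlgEquiv (tensBasis n m)

lemma tensMatrix_map (A : Fin m → Gl n) :
    tensMatrix n m (PiTensorProduct.map fun i => Matrix.toLin' (A i)) = kron A := by
  ext k l
  rw [tensMatrix, LinearMap.toMatrixAlgEquiv_apply, tensBasis_apply, stdVec,
    PiTensorProduct.map_tprod, tensBasis, Basis.piTensorProduct_repr_tprod_apply, kron_apply]
  simp

lemma tensMatrix_tensPow (A : Gl n) : tensMatrix n m (tensPow m A) = kronPow m A :=
  tensMatrix_map _

lemma tensMatrix_tensAt (i : Fin m) (A : Gl n) :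
    tensMatrix n m (tensAt i A) = kron (Function.update (fun _ => 1) i A) := by
  rw [← tensMatrix_map, tensAt]
  congr 2
  funext j
  by_cases hj : j = i
  · subst hj; simp
  · simp [hj]

lemma exists_entries (f : EquivMaps n m) :
    ∃ N : Matrix (Fin m → Fin n) (Fin m → Fin n) (MvPolynomial (Fin n × Fin n) ℂ),
      ∀ A : Gl n, N.map (evalMat A) = tensMatrix n m (f.1 A) := by
  choose N hN using fun k l : Fin m → Fin n =>
    f.2.1 (Matrix.entryLinearMap ℂ ℂ k l ∘ₗ (tensMatrix n m).toLinearMap)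
  refine ⟨Matrix.of N, fun A => ?_⟩
  ext k l
  exact (hN k l A).symm

lemma exists_sliceMatrix (f : EquivMaps n m) :
    ∃ G : Matrix (Fin m → Fin n) (Fin m → Fin n) (Ebar n),
      ∀ c : Fin n → ℂ, G.map (MvPolynomial.eval c) = tensMatrix n m (f.1 (slice c)) := by
  obtain ⟨N, hN⟩ := exists_entries f
  refine ⟨N.map (MvPolynomial.aeval fun ij => genericCompanion n ij.1 ij.2), fun c => ?_⟩
  rw [← hN]
  ext k l
  simp only [Matrix.map_apply]
  generalize N k l = p
  induction p using MvPolynomial.induction_on with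
  | C a => simp
  | add p q hp hq => simp only [map_add, hp, hq]
  | mul_X p ij hp =>
    simp only [map_mul, hp]
    rw [MvPolynomial.aeval_X, MvPolynomial.eval_X, ← genericCompanion_map_eval, Matrix.map_apply]

/-- The restriction of an equivariant map to the slice, as a matrix of polynomials. -/
def sliceMatrix (n m : ℕ) :
    EquivMaps n m →ₐ[Ebar n] Matrix (Fin m → Fin n) (Fin m → Fin n) (Ebar n) :=
  have spec (f : EquivMaps n m) := (exists_sliceMatrix f).choose_spec
  { toFun f := (exists_sliceMatrix f).choose
    map_one' := matrix_ext_eval fun c => by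
      rw [spec, Matrix.map_one _ (map_zero _) (map_one _)]
      exact map_one (tensMatrix n m)
    map_mul' f g := matrix_ext_eval fun c => by
      rw [spec, Matrix.map_mul, spec, spec]
      exact map_mul (tensMatrix n m) _ _
    map_zero' := matrix_ext_eval fun c => by
      rw [spec, Matrix.map_zero _ (map_zero _)]
      exact map_zero (tensMatrix n m)
    map_add' f g := matrix_ext_eval fun c => by
      rw [spec, Matrix.map_add _ (map_add _), spec, spec]
      exact map_add (tensMatrix n m) _ _
    commutes' p := matrix_ext_eval fun c => by
      rw [spec, Matrix.algebraMap_eq_diagonal, Matrix.diagonal_map (map_zero _)]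
      -- Linearity over `Ebar n` rests on `eig (slice c) = c`.
      have h : (algebraMap (Ebar n) (EquivMaps n m) p).1 (slice c) =
          algebraMap ℂ _ (MvPolynomial.eval (eig (slice c)) p) := rfl
      rw [h, eig_slice, AlgEquiv.commutes, Matrix.algebraMap_eq_diagonal]
      rfl }

lemma sliceMatrix_map_eval (f : EquivMaps n m) (c : Fin n → ℂ) :
    (sliceMatrix n m f).map (MvPolynomial.eval c) = tensMatrix n m (f.1 (slice c)) :=
  (exists_sliceMatrix f).choose_spec c

lemma tensMatrix_conj (f : EquivMaps n m) (g : GL (Fin n) ℂ) (A : Gl n) :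
    tensMatrix n m (f.1 ((g : Gl n) * A * ((g⁻¹ : GL (Fin n) ℂ) : Gl n))) =
      kronPow m (g : Gl n) * tensMatrix n m (f.1 A) *
        kronPow m ((g⁻¹ : GL (Fin n) ℂ) : Gl n) := by
  rw [f.2.2 g A, map_mul, map_mul, tensMatrix_tensPow, tensMatrix_tensPow]

/-- Conjugates of slice points include every matrix with the first vector cyclic; equality there
propagates to all matrices because the entries are polynomials. -/
lemma sliceMatrix_injective : Function.Injective (sliceMatrix n m) := by
  intro f f' hf
  have h0 (c : Fin n → ℂ) : tensMatrix n m (f.1 (slice c)) = tensMatrix n m (f'.1 (slice c)) := by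
    rw [← sliceMatrix_map_eval, hf, sliceMatrix_map_eval]
  obtain ⟨N, hN⟩ := exists_entries f
  obtain ⟨N', hN'⟩ := exists_entries f'
  have hNN : N = N' := by
    ext1 k l
    refine mul_left_cancel₀ (cyclicDet_firstVec_ne_zero (n := n)) (evalMat_ext fun A => ?_)
    by_cases hA : evalMat A (cyclicDet (firstVec ℂ n)) = 0
    · simp only [map_mul, hA, zero_mul]
    rw [evalMat_cyclicDet] at hA
    let U : GL (Fin n) ℂ := Matrix.GeneralLinearGroup.mkOfDetNeZero (krylov A (firstVec ℂ n)) hA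
    have hU : A * (U : Gl n) = (U : Gl n) * slice (eig A) := mul_krylov A _
    have hA' : A = (U : Gl n) * slice (eig A) * ((U⁻¹ : GL (Fin n) ℂ) : Gl n) := by
      rw [← hU, mul_assoc, Units.mul_inv, mul_one]
    have h1 : N.map (evalMat A) = N'.map (evalMat A) := by
      rw [hN, hN', hA', tensMatrix_conj, tensMatrix_conj, h0]
    have h2 := congrFun (congrFun h1 k) l
    rw [Matrix.map_apply, Matrix.map_apply] at h2
    simp only [map_mul, h2]
  refine Subtype.ext (funext fun A => (tensMatrix n m).injective ?_)
  rw [← hN, ← hN', hNN]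

/-- Conjugation by `g` fixes `slice c`, so equivariance turns into commutation. -/
lemma sliceMatrix_commute (f : EquivMaps n m) {c : Fin n → ℂ} {g : Gl n} (hg : g.det ≠ 0)
    (hc : Commute g (slice c)) :
    Commute ((sliceMatrix n m f).map (MvPolynomial.eval c)) (kronPow m g) := by
  let U : GL (Fin n) ℂ := Matrix.GeneralLinearGroup.mkOfDetNeZero g hg
  have hU : (U : Gl n) * slice c * ((U⁻¹ : GL (Fin n) ℂ) : Gl n) = slice c := by
    have h : (U : Gl n) * slice c = slice c * (U : Gl n) := hc
    rw [h, mul_assoc, Units.mul_inv, mul_one]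
  have h := tensMatrix_conj f U (slice c)
  rw [hU, ← sliceMatrix_map_eval] at h
  rw [commute_iff_eq]
  change _ * kronPow m (U : Gl n) = kronPow m (U : Gl n) * _
  conv_lhs => rw [h]
  rw [mul_assoc, ← map_mul, Units.inv_mul, map_one, mul_one]

lemma exists_sliceMatrix_eq (G : Matrix (Fin m → Fin n) (Fin m → Fin n) (Ebar n))
    (hG : ∀ (c : Fin n → ℂ) (q : Polynomial ℂ),
      Commute (G.map (MvPolynomial.eval c)) (kronPow m (Polynomial.aeval (slice c) q))) :
    ∃ f : EquivMaps n m, sliceMatrix n m f = G := by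
  obtain ⟨N, hN, hconj⟩ := exists_equivariant_extension G hG
  refine ⟨⟨fun A => (tensMatrix n m).symm (N.map (evalMat A)), fun φ => ?_, fun g A => ?_⟩,
    matrix_ext_eval fun c => ?_⟩
  · let L := φ ∘ₗ (tensMatrix n m).symm.toLinearMap
    refine ⟨∑ k, ∑ l, MvPolynomial.C (L (Matrix.single k l 1)) * N k l, fun A => ?_⟩
    change L (N.map (evalMat A)) = _
    conv_lhs => rw [Matrix.matrix_eq_sum_single (N.map (evalMat A))]
    simp only [map_sum, map_mul, MvPolynomial.eval_C]
    refine Finset.sum_congr rfl fun k _ => Finset.sum_congr rfl fun l _ => ?_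
    have h : Matrix.single k l (N.map (evalMat A) k l) =
        evalMat A (N k l) • Matrix.single k l (1 : ℂ) := by simp
    rw [h, map_smul, smul_eq_mul, mul_comm]
  · apply (tensMatrix n m).injective
    rw [map_mul, map_mul, tensMatrix_tensPow, tensMatrix_tensPow]
    simp only [AlgEquiv.apply_symm_apply]
    exact hconj g A
  · rw [sliceMatrix_map_eval, AlgEquiv.apply_symm_apply, hN]

lemma sliceMatrix_mapX (i : Fin m) : sliceMatrix n m (mapX i) =
    kron (Function.update (fun _ => 1) i (genericCompanion n)) := by
  refine matrix_ext_eval fun c => ?_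
  have h : (mapX i : EquivMaps n m).1 (slice c) = tensAt i (slice c) := rfl
  rw [sliceMatrix_map_eval, h, tensMatrix_tensAt, kron_map]
  congr 1
  funext j
  by_cases hj : j = i
  · subst hj
    rw [Function.update_self, Function.update_self, genericCompanion_map_eval]
  · rw [Function.update_of_ne hj, Function.update_of_ne hj,
      Matrix.map_one _ (map_zero _) (map_one _)]

end SliceMatrix

/-! ### Endomorphisms commuting with symmetric functions -/

section Symmetric

variable {n m : ℕ}

lemma commute_of_commute_sum_pow {ι : Type*} [Fintype ι] [DecidableEq ι] (G : Matrix ι ι ℂ)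
    (E : ℕ → Matrix ι ι ℂ) {χ : Polynomial ℂ} (hχ : χ ≠ 0)
    (h : ∀ z : ℂ, χ.eval z ≠ 0 → Commute G (∑ j ∈ Finset.range (m + 1), z ^ (m - j) • E j))
    {j : ℕ} (hj : j ≤ m) : Commute G (E j) := by
  rw [commute_iff_eq, ← sub_eq_zero]
  ext k l
  -- The coefficients of `r` are the `(k, l)` entries of the commutators with the `E j`; `r`
  -- vanishes off the roots of `χ`, hence identically.
  let r : Polynomial ℂ := ∑ j ∈ Finset.range (m + 1),
    Polynomial.C ((G * E j - E j * G) k l) * Polynomial.X ^ (m - j)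
  have hr : r = 0 := by
    refine mul_left_cancel₀ hχ (Polynomial.funext fun z => ?_)
    by_cases hz : χ.eval z = 0
    · simp [hz]
    have h1 := sub_eq_zero.2 (h z hz).eq
    have h2 := congrFun (congrFun h1 k) l
    rw [Finset.mul_sum, Finset.sum_mul, ← Finset.sum_sub_distrib, Matrix.sum_apply] at h2
    rw [mul_zero, Polynomial.eval_mul, Polynomial.eval_zero, Polynomial.eval_finsetSum]
    refine mul_eq_zero_of_right _ (Eq.trans ?_ h2)
    refine Finset.sum_congr rfl fun j _ => ?_
    rw [Matrix.mul_smul, Matrix.smul_mul, ← smul_sub, Matrix.smul_apply, smul_eq_mul]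
    simp [mul_comm]
  have hc : r.coeff (m - j) = (G * E j - E j * G) k l := by
    simp only [r, Polynomial.finsetSum_coeff, Polynomial.coeff_C_mul, Polynomial.coeff_X_pow]
    rw [Finset.sum_eq_single j]
    · simp
    · intro i hi hij
      have := Finset.mem_range.1 hi
      rw [if_neg (by omega), mul_zero]
    · intro hj'
      exact absurd (Finset.mem_range.2 (by omega)) hj'
  rw [← hc, hr, Polynomial.coeff_zero, Matrix.zero_apply]

variable {B : Type*} [CommRing B] [Algebra (Ebar n) B]
  {π : MvPolynomial (Fin m) (Ebar n) →ₐ[Ebar n] B} (β : Module.Basis (Fin m → Fin n) (Ebar n) B)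

lemma prod_X_add_C (z : Ebar n) :
    ∏ i : Fin m, (MvPolynomial.X i + MvPolynomial.C z : MvPolynomial (Fin m) (Ebar n)) =
      ∑ j ∈ Finset.range (m + 1), z ^ (m - j) • MvPolynomial.esymm (Fin m) (Ebar n) j := by
  have h := MvPolynomial.prod_C_add_X_eq_sum_esymm (Ebar n) (Fin m)
  have h2 := congrArg (Polynomial.eval (MvPolynomial.C z)) h
  simp only [Polynomial.eval_prod, Polynomial.eval_finsetSum, Fintype.card_fin] at h2
  simp only [Polynomial.eval_add, Polynomial.eval_mul, Polynomial.eval_C, Polynomial.eval_pow,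
    Polynomial.eval_X] at h2
  simp only [add_comm (MvPolynomial.X _)]
  rw [h2]
  refine Finset.sum_congr rfl fun j _ => ?_
  rw [mul_comm, MvPolynomial.smul_eq_C_mul, map_pow]

/-- At `c`, the product `∏ (x_i + z)` acts as the Kronecker power of `slice c + z`, which
centralizes `slice c`. Its expansion in `z` is the generating function of the `e_j(x)`. -/
lemma sliceMatrix_commute_esymm (hβ : ∀ k, β k = ∏ i, π (MvPolynomial.X i) ^ (k i : ℕ))
    (hx : ∀ i, Polynomial.aeval (π (MvPolynomial.X i))
      (signedPoly (MvPolynomial.X : _ → Ebar n)) = 0) (f : EquivMaps n m) {j : ℕ} (hj : j ≤ m) :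
    Commute (sliceMatrix n m f)
      (Algebra.leftMulMatrix β (π (MvPolynomial.esymm (Fin m) (Ebar n) j))) := by
  refine matrix_ext_eval fun c => ?_
  rw [Matrix.map_mul, Matrix.map_mul]
  -- The value of this `χ` at `z` is `det (slice c + z)`, so its nonvanishing is invertibility of
  -- the centralizing matrix.
  refine commute_of_commute_sum_pow (χ := (-slice c).charpoly) _ (fun j =>
    (Algebra.leftMulMatrix β (π (MvPolynomial.esymm (Fin m) (Ebar n) j))).map
      (MvPolynomial.eval c)) (Matrix.charpoly_monic _).ne_zero (fun z hz => ?_) hj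
  have h1 := congrArg (fun p => (Algebra.leftMulMatrix β (π p)).map (MvPolynomial.eval c))
    (prod_X_add_C (n := n) (m := m) (MvPolynomial.C z))
  have h2 : π (∏ i, (MvPolynomial.X i + MvPolynomial.C (MvPolynomial.C z))) =
      ∏ i : Fin m, Polynomial.aeval (π (MvPolynomial.X i))
        (Polynomial.X + Polynomial.C (MvPolynomial.C z : Ebar n)) := by
    rw [map_prod]
    refine Finset.prod_congr rfl fun i _ => ?_
    rw [map_add, map_add, Polynomial.aeval_X, Polynomial.aeval_C]
    congr 1
    exact AlgHom.commutes π _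
  have h3 : (Polynomial.aeval (genericCompanion n)
      (Polynomial.X + Polynomial.C (MvPolynomial.C z : Ebar n))).map (MvPolynomial.eval c) =
      slice c + Matrix.scalar (Fin n) z := by
    rw [map_add, Polynomial.aeval_X, Polynomial.aeval_C, Matrix.map_add _ (map_add _),
      genericCompanion_map_eval, Matrix.algebraMap_eq_diagonal, Matrix.diagonal_map (map_zero _)]
    congr 1
    ext i j
    simp [Matrix.diagonal_apply]
  have h4 : (Algebra.leftMulMatrix β (π (∑ j ∈ Finset.range (m + 1),
      (MvPolynomial.C z : Ebar n) ^ (m - j) • MvPolynomial.esymm (Fin m) (Ebar n) j))).map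
      (MvPolynomial.eval c) = ∑ j ∈ Finset.range (m + 1), z ^ (m - j) •
        (Algebra.leftMulMatrix β (π (MvPolynomial.esymm (Fin m) (Ebar n) j))).map
          (MvPolynomial.eval c) := by
    ext k l
    simp only [map_sum, map_smul, Matrix.map_apply, Matrix.sum_apply, Matrix.smul_apply,
      smul_eq_mul, map_mul, map_pow, MvPolynomial.eval_C]
  rw [h4, h2, leftMulMatrix_prod_aeval β hβ hx, ← kronPow_apply, kronPow_map, h3] at h1
  rw [← h1]
  refine sliceMatrix_commute f ?_ ?_
  · rwa [Matrix.eval_charpoly, sub_neg_eq_add, add_comm] at hz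
  · exact (Commute.refl _).add_left (Matrix.scalar_commute z (fun _ => Commute.all _ _) _)

/-- The elementary symmetric polynomials generate the symmetric ones, and the commutant is closed
under sums and products. -/
lemma sliceMatrix_commute_symmetric (hβ : ∀ k, β k = ∏ i, π (MvPolynomial.X i) ^ (k i : ℕ))
    (hx : ∀ i, Polynomial.aeval (π (MvPolynomial.X i))
      (signedPoly (MvPolynomial.X : _ → Ebar n)) = 0) (f : EquivMaps n m)
    {p : MvPolynomial (Fin m) (Ebar n)} (hp : p.IsSymmetric) :
    Commute (sliceMatrix n m f) (Algebra.leftMulMatrix β (π p)) := by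
  obtain ⟨q, hq⟩ := MvPolynomial.esymmAlgHom_surjective (σ := Fin m) (Ebar n) (n := m)
    (Fintype.card_fin m).le ⟨p, hp⟩
  have hq' := (MvPolynomial.esymmAlgHom_apply (σ := Fin m) (R := Ebar n) (n := m) q)
  rw [hq] at hq'
  change p = _ at hq'
  rw [hq']
  clear hq hq' hp
  induction q using MvPolynomial.induction_on with
  | C a =>
    rw [MvPolynomial.aeval_C, AlgHom.commutes, AlgHom.commutes]
    exact (Algebra.commutes a _).symm
  | add p q hp hq => rw [map_add, map_add, map_add]; exact hp.add_right hq
  | mul_X p i hp =>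
    rw [map_mul, map_mul, map_mul, MvPolynomial.aeval_X]
    exact hp.mul_right (sliceMatrix_commute_esymm β hβ hx f i.2)

lemma aeval_genericCompanion_map_eval (c : Fin n → ℂ) (q : Polynomial ℂ) :
    (Polynomial.aeval (genericCompanion n) (q.map (MvPolynomial.C : ℂ →+* Ebar n))).map
      (MvPolynomial.eval c) =
      Polynomial.aeval (slice c) q := by
  rw [← RingHom.mapMatrix_apply, Polynomial.aeval_def, Polynomial.eval₂_map, Polynomial.hom_eval₂,
    RingHom.mapMatrix_apply, genericCompanion_map_eval, Polynomial.aeval_def]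
  congr 1
  ext z i j
  by_cases h : i = j <;> simp [Matrix.algebraMap_matrix_apply, h]

lemma exists_sliceMatrix_eq_of_commute (hβ : ∀ k, β k = ∏ i, π (MvPolynomial.X i) ^ (k i : ℕ))
    (hx : ∀ i, Polynomial.aeval (π (MvPolynomial.X i))
      (signedPoly (MvPolynomial.X : _ → Ebar n)) = 0)
    (G : Matrix (Fin m → Fin n) (Fin m → Fin n) (Ebar n))
    (hG : ∀ p : MvPolynomial (Fin m) (Ebar n), p.IsSymmetric →
      Commute G (Algebra.leftMulMatrix β (π p))) :
    ∃ f : EquivMaps n m, sliceMatrix n m f = G := by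
  refine exists_sliceMatrix_eq G fun c q => ?_
  let q' : Polynomial (Ebar n) := q.map MvPolynomial.C
  -- The product `∏ q(x_i)` is symmetric and acts at `c` by the Kronecker power of `q(slice c)`,
  -- which is the commutation required for extending `G`.
  let p : MvPolynomial (Fin m) (Ebar n) := ∏ i, Polynomial.aeval (MvPolynomial.X i) q'
  have hp : p.IsSymmetric := by
    intro e
    simp only [p, map_prod, ← Polynomial.aeval_algHom_apply, MvPolynomial.rename_X]
    exact Equiv.prod_comp e fun i => Polynomial.aeval (MvPolynomial.X i) q'
  have h := hG p hp
  have hπ : π p = ∏ i, Polynomial.aeval (π (MvPolynomial.X i)) q' := by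
    simp only [p, map_prod, Polynomial.aeval_algHom_apply]
  rw [hπ, leftMulMatrix_prod_aeval β hβ hx, ← kronPow_apply] at h
  have h3 := h.map (MvPolynomial.eval c).mapMatrix
  rw [RingHom.mapMatrix_apply, RingHom.mapMatrix_apply, kronPow_map,
    aeval_genericCompanion_map_eval] at h3
  exact h3

end Symmetric

/-! ### The isomorphism -/

section Isomorphism

variable {n m : ℕ} {B : Type*} [CommRing B] [Algebra (Ebar n) B]

/-- The subalgebra of `End(B)` generated by the multiplications by images of symmetric
polynomials. -/
def symmetricMul (π : MvPolynomial (Fin m) (Ebar n) →ₐ[Ebar n] B) :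
    Subalgebra (Ebar n) (Module.End (Ebar n) B) :=
  Algebra.adjoin (Ebar n) {T | ∃ p : MvPolynomial (Fin m) (Ebar n), p.IsSymmetric ∧
    T = Algebra.lmul (Ebar n) B (π p)}

variable {π : MvPolynomial (Fin m) (Ebar n) →ₐ[Ebar n] B}
  (β : Module.Basis (Fin m → Fin n) (Ebar n) B)

lemma commute_symmetricMul {T : Module.End (Ebar n) B}
    (hT : ∀ p : MvPolynomial (Fin m) (Ebar n), p.IsSymmetric →
      Commute T (Algebra.lmul (Ebar n) B (π p))) (σ : symmetricMul π) :
    Commute T σ.1 := by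
  have h : symmetricMul π ≤ Subalgebra.centralizer (Ebar n) {T} := by
    refine Algebra.adjoin_le ?_
    rintro _ ⟨p, hp, rfl⟩
    rw [SetLike.mem_coe, Subalgebra.mem_centralizer_iff]
    rintro _ rfl
    exact hT p hp
  exact (Subalgebra.mem_centralizer_iff _).1 (h σ.2) T rfl

lemma sliceMatrix_toLin_commute (hβ : ∀ k, β k = ∏ i, π (MvPolynomial.X i) ^ (k i : ℕ))
    (hx : ∀ i, Polynomial.aeval (π (MvPolynomial.X i))
      (signedPoly (MvPolynomial.X : _ → Ebar n)) = 0) (f : EquivMaps n m)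
    (σ : symmetricMul π) : Commute (Matrix.toLinAlgEquiv β (sliceMatrix n m f)) σ.1 := by
  refine commute_symmetricMul (fun p hp => ?_) σ
  have h := (sliceMatrix_commute_symmetric β hβ hx f hp).map (Matrix.toLinAlgEquiv β)
  rwa [show Matrix.toLinAlgEquiv β (Algebra.leftMulMatrix β (π p)) =
    Algebra.lmul (Ebar n) B (π p) from Matrix.toLin_toMatrix β β _] at h

/-- The action of an equivariant map on `B` through its restriction to the slice. -/
def sliceHom (hβ : ∀ k, β k = ∏ i, π (MvPolynomial.X i) ^ (k i : ℕ))
    (hx : ∀ i, Polynomial.aeval (π (MvPolynomial.X i))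
      (signedPoly (MvPolynomial.X : _ → Ebar n)) = 0) :
    EquivMaps n m →ₐ[Ebar n] Module.End (symmetricMul π) B where
  toFun f :=
    { toFun r := Matrix.toLinAlgEquiv β (sliceMatrix n m f) r
      map_add' := map_add _
      map_smul' σ r := DFunLike.congr_fun (sliceMatrix_toLin_commute β hβ hx f σ).eq r }
  map_one' := by ext r; simp
  map_mul' f g := by ext r; simp
  map_zero' := by ext r; simp
  map_add' f g := by ext r; simp
  commutes' p := by
    ext r
    change Matrix.toLinAlgEquiv β (sliceMatrix n m (algebraMap _ _ p)) r = p • r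
    rw [AlgHom.commutes, AlgEquiv.commutes]
    rfl

lemma sliceHom_apply (hβ : ∀ k, β k = ∏ i, π (MvPolynomial.X i) ^ (k i : ℕ))
    (hx : ∀ i, Polynomial.aeval (π (MvPolynomial.X i))
      (signedPoly (MvPolynomial.X : _ → Ebar n)) = 0) (f : EquivMaps n m) (r : B) :
    sliceHom β hβ hx f r = Matrix.toLinAlgEquiv β (sliceMatrix n m f) r := rfl

lemma sliceHom_bijective (hβ : ∀ k, β k = ∏ i, π (MvPolynomial.X i) ^ (k i : ℕ))
    (hx : ∀ i, Polynomial.aeval (π (MvPolynomial.X i))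
      (signedPoly (MvPolynomial.X : _ → Ebar n)) = 0) :
    Function.Bijective (sliceHom β hβ hx) := by
  constructor
  · intro f g h
    refine sliceMatrix_injective ((Matrix.toLinAlgEquiv β).injective (LinearMap.ext fun r => ?_))
    exact DFunLike.congr_fun h r
  · intro T
    -- The scalars of `Ebar n` lie in the subalgebra `symmetricMul π`, so `T` is also linear over
    -- `Ebar n` and has a matrix.
    let T' : Module.End (Ebar n) B :=
      { toFun := T
        map_add' := map_add T
        map_smul' a r := by
          have h := map_smul T (algebraMap (Ebar n) (symmetricMul π) a) r
          exact h }
    obtain ⟨f, hf⟩ := exists_sliceMatrix_eq_of_commute β hβ hx (LinearMap.toMatrixAlgEquiv β T')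
      (fun p hp => by
        refine Commute.map (x := T') (y := Algebra.lmul (Ebar n) B (π p)) ?_
          (LinearMap.toMatrixAlgEquiv β)
        ext r
        exact map_smul T (⟨_, Algebra.subset_adjoin ⟨p, hp, rfl⟩⟩ : symmetricMul π) r)
    refine ⟨f, LinearMap.ext fun r => ?_⟩
    rw [sliceHom_apply, hf, Matrix.toLinAlgEquiv_toMatrixAlgEquiv]
    rfl

lemma tensBasis_repr_evalAt (c : Fin n → ℂ) (z : Ebar n ⊗[ℂ] Tens n m) (k : Fin m → Fin n) :
    (tensBasis n m).repr (evalAt m c z) k =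
      MvPolynomial.eval c (((tensBasis n m).baseChange (Ebar n)).repr z k) := by
  induction z with
  | zero => simp
  | add x y hx hy => simp only [map_add, Finsupp.add_apply, hx, hy]
  | tmul p t =>
    simp [evalAt, mul_comm, Module.Basis.baseChange_repr_tmul, MvPolynomial.aeval_eq_eval]

/-- The slice isomorphism for an algebra presented like `R̄ₙᵐ`. -/
theorem exists_slice_isomorphism (hπ : Function.Surjective π) (hker : RingHom.ker π =
      Ideal.span (Set.range fun i : Fin m => Polynomial.aeval (MvPolynomial.X i)
        (signedPoly (MvPolynomial.X : _ → Ebar n)))) :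
    ∃ (ψ : (Ebar n ⊗[ℂ] Tens n m) ≃ₗ[Ebar n] B)
      (γ : EquivMaps n m ≃ₐ[Ebar n] Module.End (symmetricMul π) B),
      (∀ k : Fin m → Fin n, ψ (1 ⊗ₜ[ℂ] stdVec k) = ∏ i, π (MvPolynomial.X i) ^ (k i : ℕ)) ∧
      (∀ (f : EquivMaps n m) (c : Fin n → ℂ) (z : Ebar n ⊗[ℂ] Tens n m),
        evalAt m c (ψ.symm (γ f (ψ z))) = f.1 (slice c) (evalAt m c z)) ∧
      (∀ (i : Fin m) (r : B), γ (mapX i) r = π (MvPolynomial.X i) * r) := by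
  let β := monomBasis hπ hker
  have hβ : ∀ k, β k = ∏ i, π (MvPolynomial.X i) ^ (k i : ℕ) := monomBasis_apply hπ hker
  have hx := aeval_signedPoly_of_ker hker
  let b := (tensBasis n m).baseChange (Ebar n)
  let ψ := b.equiv β (Equiv.refl _)
  have hψ (z : Ebar n ⊗[ℂ] Tens n m) : β.repr (ψ z) = b.repr z := by
    simp [ψ, Module.Basis.equiv]
  refine ⟨ψ, AlgEquiv.ofBijective (sliceHom β hβ hx) (sliceHom_bijective β hβ hx),
    fun k => ?_, fun f c z => ?_, fun i r => ?_⟩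
  · have h : b k = 1 ⊗ₜ[ℂ] stdVec k := by
      simp [b, tensBasis_apply]
    rw [← h, ← hβ]
    simp [ψ]
  · refine (tensBasis n m).ext_elem fun k => ?_
    have h1 : b.repr (ψ.symm (sliceHom β hβ hx f (ψ z))) =
        (sliceMatrix n m f).mulVec (b.repr z) := by
      rw [← hψ, LinearEquiv.apply_symm_apply, sliceHom_apply, ← hψ]
      have h := LinearMap.toMatrix_mulVec_repr β β (Matrix.toLin β β (sliceMatrix n m f)) (ψ z)
      rw [LinearMap.toMatrix_toLin] at h
      exact h.symm
    have h2 : (tensBasis n m).repr (f.1 (slice c) (evalAt m c z)) =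
        (tensMatrix n m (f.1 (slice c))).mulVec ((tensBasis n m).repr (evalAt m c z)) :=
      (LinearMap.toMatrix_mulVec_repr (tensBasis n m) (tensBasis n m) _ _).symm
    rw [AlgEquiv.ofBijective_apply, tensBasis_repr_evalAt, h1, h2, ← sliceMatrix_map_eval,
      RingHom.map_mulVec]
    congr 1
    funext l
    exact (tensBasis_repr_evalAt c z l).symm
  · rw [AlgEquiv.ofBijective_apply, sliceHom_apply, sliceMatrix_mapX,
      ← leftMulMatrix_root β hβ hx]
    exact DFunLike.congr_fun (Matrix.toLin_toMatrix β β (Algebra.lmul (Ebar n) B _)) r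

end Isomorphism

lemma relation_eq_aeval {n m : ℕ} (i : Fin m) : relation n m i =
    Polynomial.aeval (MvPolynomial.X i) (signedPoly (MvPolynomial.X : _ → Ebar n)) := by
  rw [aeval_signedPoly, relation]
  congr 1
  refine Finset.sum_congr rfl fun j _ => ?_
  simp [Algebra.smul_def, MvPolynomial.algebraMap_eq]

end KostantSlice

end

/-- Restriction to the companion-matrix slice is an isomorphism of `Ē`-algebras
`Maps_{GLₙ}(𝔤𝔩ₙ, End((ℂⁿ)^{⊗ m})) ≃ End_{Sym(x)}(R̄ₙᵐ)`. The restriction `f ∘ s` acts on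
`Ē ⊗ (ℂⁿ)^{⊗ m}` (at each point `c` of `Spec Ē` by `f (s(c))`), and this module is identified with
`R̄ₙᵐ` through `v_{k₁} ⊗ ⋯ ⊗ v_{kₘ} ↦ x₁^{k₁ - 1} ⋯ xₘ^{kₘ - 1}` (indices `k_i` from `1`). -/
theorem mainTheorem9 (n m : ℕ) :
    ∃ (ψ : (Ebar n ⊗[ℂ] Tens n m) ≃ₗ[Ebar n] Rbar n m)
      (γ : EquivMaps n m ≃ₐ[Ebar n] Module.End (SymX n m) (Rbar n m)),
      (∀ k : Fin m → Fin n, ψ (1 ⊗ₜ[ℂ] stdVec k) = ∏ i, xbar i ^ (k i : ℕ)) ∧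
      (∀ (f : EquivMaps n m) (c : Fin n → ℂ) (z : Ebar n ⊗[ℂ] Tens n m),
        evalAt m c (ψ.symm (γ f (ψ z))) = f.1 (slice c) (evalAt m c z)) ∧
      (∀ (i : Fin m) (r : Rbar n m), γ (mapX i) r = xbar i * r) := by
  let π : MvPolynomial (Fin m) (Ebar n) →ₐ[Ebar n] Rbar n m :=
    Ideal.Quotient.mkₐ (Ebar n) (Ideal.span (Set.range (relation n m)))
  have h := exists_slice_isomorphism (n := n) (m := m) (B := Rbar n m) (π := π)
    (Ideal.Quotient.mkₐ_surjective (Ebar n) _) (by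
      rw [← funext relation_eq_aeval]
      exact Ideal.Quotient.mkₐ_ker (Ebar n) _)
  obtain ⟨ψ, γ, h1, h2, h3⟩ := h
  -- For this `π`, `symmetricMul π` agrees with `SymX n m` by definition, and `π (X i)` with `xbar
  -- i`.
  exact ⟨ψ, γ, h1, h2, h3⟩
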